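/- Call a subfield $K$ of $\mathbb{C}$ an imaginary cyclic quartic field if $[K:\mathbb{Q}]=4$, $K/\mathbb{Q}$ is Galois with cyclic Galois group, and $K$ has no real embedding. For rational $s,t\neq 0$ let $K_{s,t}\subset\mathbb{C}$ be the splitting field over $\mathbb{Q}$ of $X^4-2s(t^2+1)X^2+s^2t^2(t^2+1)$. **Theorem 1.3.** For every real $M>0$ there is a real number $R>M$ such that: (i) there are infinitely many imaginary cyclic quartic fields with regulator $R$; (ii) there are infinitely many pairs $(K_1,K_2)$ of distinct imaginary cyclic quartic fields with equal discriminants and with both regulators equal to $R$. Moreover, these fields can be given explicitly: there is a positive integer $t\equiv 5\pmod 8$ such that, for every prime $p>t^2+1$, the fields $K_{-p,t}$ and $K_{-2p,t}$ are distinct imaginary cyclic quartic fields with equal discriminants and with both regulators equal to $R$; and for distinct primes $p,q>t^2+1$, neither of the fields $K_{-p,t},K_{-2p,t}$ equals either of the fields $K_{-q,t},K_{-2q,t}$. -/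

import Mathlib

open Polynomial

namespace QuarticCM

/-- A number field in the concrete sense: a subfield of `ℂ` of finite degree over `ℚ`.
Equality of two such objects is equality of subfields of `ℂ`. -/
abbrev NumField : Type := {K : IntermediateField ℚ ℂ // FiniteDimensional ℚ K}

instance instNumberField (K : NumField) : NumberField K.1 :=
  { to_charZero := inferInstance
    to_finiteDimensional := K.2 }

/-- The (absolute) discriminant of a number field. -/
noncomputable def disc (K : NumField) : ℤ := NumberField.discr K.1

/-- The regulator of a number field. -/
noncomputable def reg (K : NumField) : ℝ := NumberField.Units.regulator K.1

/-- `K` is an imaginary cyclic quartic field: it has degree `4` over `ℚ`, is Galois over `ℚ`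
with cyclic Galois group, and has no real embedding. -/
structure IsImaginaryCyclicQuartic (K : NumField) : Prop where
  finrank_eq : Module.finrank ℚ K.1 = 4
  isGalois : IsGalois ℚ K.1
  isCyclic : IsCyclic (K.1 ≃ₐ[ℚ] K.1)
  isTotallyComplex : NumberField.IsTotallyComplex K.1

/-- The polynomial `X⁴ - 2s(t² + 1)X² + s²t²(t² + 1)` over `ℚ`. -/
noncomputable def quarticPoly (s t : ℚ) : ℚ[X] :=
  X ^ 4 - C (2 * s * (t ^ 2 + 1)) * X ^ 2 + C (s ^ 2 * t ^ 2 * (t ^ 2 + 1))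

/-- The field `K_{s,t}`: the splitting field of `quarticPoly s t` over `ℚ` inside `ℂ`, that is,
the subfield of `ℂ` generated by all complex roots of this polynomial. -/
noncomputable def quarticField (s t : ℚ) : NumField :=
  ⟨IntermediateField.adjoin ℚ ((quarticPoly s t).rootSet ℂ), by
    have : Finite ((quarticPoly s t).rootSet ℂ) := ((quarticPoly s t).rootSet_finite ℂ).to_subtype
    exact IntermediateField.finiteDimensional_adjoin
      (fun x hx => (isAlgebraic_of_mem_rootSet hx).isIntegral)⟩

end QuarticCM

/-! Write t² + 1 = d m² with d squarefree, so that ε = t + m√d is a unit of norm −1, and write m = a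
b² with a squarefree. Up to squares in ℚ(√d), the roots of the quartic are square roots of −c n √d ε
with n = p a, where c = 2 for K_{-p,t} and c = 1 for K_{-2p,t} (`exists_cgen`). Since √d ε is
totally positive and its norm is d, which is a square in ℚ(√d), each field is a cyclic quartic CM
field over ℚ(√d).

Discriminant: as d ≡ 2 mod 4, the integers have the ℤ-basis 1, √d, α, ρ√d α with ρ = lcm(n,d)/(c n
d). The factor c cancels in the determinant, leaving 256 d lcm(n,d)² (`Gen.disc_eq`), the same for c
= 1 and c = 2.

Regulator: every unit lies in ℤ[√d] (`Gen.unit_coords`). The unit rank is one, so the unit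
logarithms are the integral multiples of the regulator (`exists_unit_log_iff`), which therefore
depends on d alone. A unit of ℤ[√d] of absolute value above 1 has absolute value at least √d, so the
regulator is at least log d, and `exists_param` makes d as large as desired.

Distinctness: equality of two of the fields forces c n / (c' n') to be a rational square or d times
one (`CGen.ratio_eq`). For primes exceeding d this is impossible unless both p and c agree
(`not_sq_of_primes`). -/

namespace QuarticCM

/-- Arithmetic conditions on the parameters of the quartic field generated by a square root of
`-c n √d (t + m √d)`, where `t + m √d` is a unit of norm `-1`. -/
structure Params (d n t m c : ℕ) : Prop where
  sqf_d : Squarefree d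
  d_mod : d % 4 = 2
  two_lt : 2 < d
  sqf_n : Squarefree n
  n_odd : n % 2 = 1
  c_eq : c = 1 ∨ c = 2
  norm : t ^ 2 + 1 = d * m ^ 2

/-! ### Integrality of coordinates in ℚ(√d) -/

lemma exists_int_of_sq_eq {q : ℚ} {k : ℤ} (h : q ^ 2 = k) : ∃ j : ℤ, q = j := by
  have hq : IsIntegral ℤ q := by
    apply IsIntegral.of_pow (n := 2) (by norm_num)
    rw [h]; exact isIntegral_algebraMap (R := ℤ) (x := k)
  obtain ⟨j, hj⟩ := IsIntegrallyClosed.isIntegral_iff.mp hq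
  exact ⟨j, by simpa using hj.symm⟩

lemma exists_int_of_squarefree_mul_sq {d : ℕ} (hd : Squarefree d) {q : ℚ} {k : ℤ}
    (h : d * q ^ 2 = k) : ∃ j : ℤ, q = j := by
  have hd0 : (d : ℤ) ≠ 0 := by exact_mod_cast hd.ne_zero
  obtain ⟨j, hj⟩ := exists_int_of_sq_eq (q := d * q) (k := d * k) (by push_cast; rw [← h]; ring)
  have h1 : (d : ℤ) * k = j ^ 2 := by
    have : ((d : ℚ) * k) = j ^ 2 := by rw [← hj, ← h]; ring
    exact_mod_cast this
  have h2 : (d : ℤ) ∣ j := by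
    have : (d : ℤ) ∣ j ^ 2 := ⟨k, h1.symm⟩
    exact ((Int.squarefree_natCast.mpr hd).dvd_pow_iff_dvd two_ne_zero).mp this
  obtain ⟨i, hi⟩ := h2
  refine ⟨i, ?_⟩
  have : (d : ℚ) * q = d * i := by rw [hj, hi]; push_cast; ring
  exact mul_left_cancel₀ (by exact_mod_cast hd.ne_zero) this

lemma dvd_of_forall_prime_dvd {n : ℕ} (hn : Squarefree n) {e : ℤ}
    (h : ∀ q : ℕ, q.Prime → q ∣ n → (q : ℤ) ∣ e) : (n : ℤ) ∣ e := by
  rw [← Nat.prod_primeFactors_of_squarefree hn, Int.natCast_dvd]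
  apply Finset.prod_primes_dvd
  · intro q hq
    exact (Nat.prime_of_mem_primeFactors hq).prime
  · intro q hq
    exact Int.natCast_dvd.mp
      (h q (Nat.prime_of_mem_primeFactors hq) (Nat.dvd_of_mem_primeFactors hq))

/-- If `e² + d f²` is divisible by four, where `d ≡ 2 mod 4`, then `e` and `f` are even. -/
lemma even_of_sq_add_mul_sq {d e f : ℤ} (hd : d % 4 = 2) (h : (4 : ℤ) ∣ e ^ 2 + d * f ^ 2) :
    2 ∣ e ∧ 2 ∣ f := by
  obtain ⟨k, hk⟩ := h
  obtain ⟨j, rfl⟩ : ∃ j, d = 4 * j + 2 := ⟨d / 4, by omega⟩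
  rcases Int.even_or_odd' e with ⟨e', rfl | rfl⟩
  · refine ⟨⟨e', rfl⟩, ?_⟩
    rcases Int.even_or_odd' f with ⟨f', rfl | rfl⟩
    · exact ⟨f', rfl⟩
    · exfalso; ring_nf at hk; omega
  · exfalso
    ring_nf at hk; omega

/-- Integral elements of `ℚ(√d)` have integral coordinates when `d ≡ 2 mod 4`. -/
lemma int_coords_of_trace_norm {d : ℕ} (hd : Squarefree d) (hd4 : d % 4 = 2) {x y : ℚ} {k l : ℤ}
    (hk : 2 * x = k) (hl : x ^ 2 - d * y ^ 2 = l) :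
    ∃ i j : ℤ, x = i ∧ y = j := by
  obtain ⟨v, hv⟩ := exists_int_of_squarefree_mul_sq hd (q := 2 * y) (k := k ^ 2 - 4 * l)
    (by push_cast; rw [← hk, ← hl]; ring)
  have h : (k ^ 2 - d * v ^ 2 : ℤ) = 4 * l := by
    have : (k ^ 2 - d * v ^ 2 : ℚ) = 4 * l := by rw [← hk, ← hv, ← hl]; ring
    exact_mod_cast this
  obtain ⟨⟨i, rfl⟩, ⟨j, rfl⟩⟩ := even_of_sq_add_mul_sq (d := -d) (e := k) (f := v) (by omega)
    ⟨l, by linarith⟩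
  push_cast at hk hv
  exact ⟨i, j, by linarith, by linarith⟩

/-- Elements of `ℚ(√d)` whose square has integral coordinates have integral coordinates. -/
lemma int_coords_of_sq {d : ℕ} (hd : Squarefree d) (hd4 : d % 4 = 2) {x y : ℚ} {k l : ℤ}
    (hk : x ^ 2 + d * y ^ 2 = k) (hl : 2 * x * y = l) :
    ∃ i j : ℤ, x = i ∧ y = j := by
  -- N is the norm of x + y√d, and N² is the norm of its square. The trace 2x then satisfies (2x)² =
  -- 2(k + N).
  obtain ⟨N, hN⟩ := exists_int_of_sq_eq (q := x ^ 2 - d * y ^ 2) (k := k ^ 2 - d * l ^ 2)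
    (by push_cast; rw [← hk, ← hl]; ring)
  obtain ⟨u, hu⟩ := exists_int_of_sq_eq (q := 2 * x) (k := 2 * (k + N))
    (by push_cast; rw [← hk, ← hN]; ring)
  exact int_coords_of_trace_norm hd hd4 hu hN

/-! ### Arithmetic of the parameters and integrality conditions for the quartic field -/

namespace Params

variable {d n t m c : ℕ}

lemma d_pos (h : Params d n t m c) : 0 < d := by have := h.two_lt; omega
lemma n_pos (h : Params d n t m c) : 0 < n := by have := h.n_odd; omega
lemma c_pos (h : Params d n t m c) : 0 < c := by rcases h.c_eq with h | h <;> omega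

lemma t_odd (h : Params d n t m c) : t % 2 = 1 := by
  have h1 := h.norm
  have h2 := h.d_mod
  rcases Nat.even_or_odd' t with ⟨s, rfl | rfl⟩
  · exfalso
    obtain ⟨j, rfl⟩ : ∃ j, d = 4 * j + 2 := ⟨d / 4, by omega⟩
    ring_nf at h1; omega
  · omega

lemma norm_rat (h : Params d n t m c) : (d * m ^ 2 - t ^ 2 : ℚ) = 1 := by
  have := h.norm
  have h' : (t ^ 2 + 1 : ℚ) = d * m ^ 2 := by exact_mod_cast this
  linarith

lemma not_sq (h : Params d n t m c) (q : ℚ) : q ^ 2 ≠ d := by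
  intro hq
  obtain ⟨j, rfl⟩ := exists_int_of_sq_eq (q := q) (k := d) (by simpa using hq)
  have h1 : j * j ∣ (d : ℤ) := ⟨1, by
    have : (j ^ 2 : ℤ) = d := by exact_mod_cast hq
    linarith⟩
  have h2 := (Int.squarefree_natCast.mpr h.sqf_d) j h1
  have h3 : (j ^ 2 : ℤ) = d := by exact_mod_cast hq
  rw [Int.isUnit_iff] at h2
  have := h.two_lt
  rcases h2 with rfl | rfl <;> norm_num at h3 <;> omega

lemma mul_sq_ne_one (h : Params d n t m c) (q : ℚ) : d * q ^ 2 ≠ 1 := by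
  intro hq
  have h0 : q ≠ 0 := by rintro rfl; simp at hq
  apply h.not_sq (1 / q)
  field_simp
  linarith

lemma coords_eq_zero (h : Params d n t m c) {x y : ℚ} (hxy : x ^ 2 = d * y ^ 2) :
    x = 0 ∧ y = 0 := by
  by_cases hy : y = 0
  · subst hy; simpa using hxy
  · exact absurd (show (x / y) ^ 2 = d by field_simp; linarith) (h.not_sq _)

lemma lcm_even (_h : Params d n t m c) : 2 ∣ Nat.lcm n d := by
  have := _h.d_mod
  exact (show 2 ∣ d by omega).trans (Nat.dvd_lcm_right n d)

/-- This makes lcm(n,d)/(c n d) · √d α integral. For c = 2 the extra factor is available because d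
is even and n odd: both n and d/2 divide lcm(n,d)/2. -/
lemma dvd_lcm_sq (h : Params d n t m c) : c * n * d ∣ Nat.lcm n d ^ 2 := by
  have hnd : n * d ∣ Nat.lcm n d ^ 2 := by
    rw [sq]; exact mul_dvd_mul (Nat.dvd_lcm_left n d) (Nat.dvd_lcm_right n d)
  rcases h.c_eq with rfl | rfl
  · simpa using hnd
  · obtain ⟨e, he⟩ : 2 ∣ d := by have := h.d_mod; omega
    obtain ⟨l, hl⟩ := h.lcm_even
    have hn2 : Nat.Coprime n 2 := by
      rw [Nat.coprime_comm, Nat.coprime_two_left, Nat.odd_iff]; exact h.n_odd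
    have h1 : n ∣ l := by
      have : n ∣ 2 * l := hl ▸ Nat.dvd_lcm_left n d
      exact hn2.dvd_of_dvd_mul_left this
    have h2 : e ∣ l := by
      have : 2 * e ∣ 2 * l := by rw [← hl, ← he]; exact Nat.dvd_lcm_right n d
      exact Nat.dvd_of_mul_dvd_mul_left two_pos this
    rw [hl, he]
    calc 2 * n * (2 * e) = 4 * (n * e) := by ring
      _ ∣ 4 * (l * l) := mul_dvd_mul_left _ (mul_dvd_mul h1 h2)
      _ = (2 * l) ^ 2 := by ring

/-- Argue at each prime q dividing n, which is odd: q divides e or f, and the quadratic form passes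
this to the other one. The factor c = 2 is handled by a congruence mod 4, and d ∣ e follows from d ∣
e². -/
lemma dvd_of_mul_dvd (h : Params d n t m c) {e f : ℤ} (h1 : (c * n : ℤ) ∣ 2 * e * f)
    (h2 : (c * n * d : ℤ) ∣ e ^ 2 + d * f ^ 2) : (c * n : ℤ) ∣ f ∧ (Nat.lcm n d : ℤ) ∣ e := by
  have key : ∀ q : ℕ, q.Prime → q ∣ n → (q : ℤ) ∣ e ∧ (q : ℤ) ∣ f := by
    intro q hq hqn
    have hqp := Nat.prime_iff_prime_int.mp hq
    have hq2 : ¬ (q : ℤ) ∣ 2 := by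
      intro h3
      have h4 : q ∣ 2 := by exact_mod_cast h3
      obtain rfl : q = 2 := (Nat.prime_dvd_prime_iff_eq hq Nat.prime_two).mp h4
      have := h.n_odd
      omega
    have hef : (q : ℤ) ∣ e * f := by
      have : (q : ℤ) ∣ 2 * (e * f) := by
        rw [← mul_assoc]
        exact ((Int.natCast_dvd_natCast.mpr hqn).trans (Dvd.intro_left _ rfl)).trans h1
      exact (hqp.dvd_or_dvd this).resolve_left hq2
    -- If q ∣ d, the form is divisible by q², one factor from n and one from d. This pays for a
    -- second division by q after q ∣ e is known.
    by_cases hqd : q ∣ d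
    · obtain ⟨d', rfl⟩ := hqd
      obtain ⟨n', rfl⟩ := hqn
      have hq0 : (q : ℤ) ≠ 0 := by exact_mod_cast hq.ne_zero
      have hd' : ¬ (q : ℤ) ∣ d' := by
        intro h3
        have h4 : q ∣ d' := by exact_mod_cast h3
        have := h.sqf_d q (mul_dvd_mul_left q h4)
        exact hq.one_lt.ne' (Nat.isUnit_iff.mp this)
      obtain ⟨k, hk⟩ := h2
      push_cast at hk
      have he : (q : ℤ) ∣ e := by
        apply hqp.dvd_of_dvd_pow (n := 2)
        exact ⟨c * (q * n') * d' * k - d' * f ^ 2, by linear_combination hk⟩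
      refine ⟨he, ?_⟩
      obtain ⟨e', rfl⟩ := he
      have : (q : ℤ) ∣ d' * f ^ 2 := by
        refine ⟨c * n' * d' * k - e' ^ 2, ?_⟩
        apply mul_left_cancel₀ hq0
        linear_combination hk
      exact hqp.dvd_of_dvd_pow ((hqp.dvd_or_dvd this).resolve_left hd')
    · have hd' : ¬ (q : ℤ) ∣ d := by exact_mod_cast hqd
      have h3 : (q : ℤ) ∣ e ^ 2 + d * f ^ 2 := by
        refine ((Int.natCast_dvd_natCast.mpr hqn).trans ?_).trans h2
        exact ⟨c * d, by ring⟩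
      rcases hqp.dvd_or_dvd hef with h4 | h4
      · refine ⟨h4, ?_⟩
        have : (q : ℤ) ∣ d * f ^ 2 := (dvd_add_right (dvd_pow h4 two_ne_zero)).mp h3
        exact hqp.dvd_of_dvd_pow ((hqp.dvd_or_dvd this).resolve_left hd')
      · refine ⟨?_, h4⟩
        have : (q : ℤ) ∣ e ^ 2 :=
          (dvd_add_left (Dvd.dvd.mul_left (dvd_pow h4 two_ne_zero) _)).mp h3
        exact hqp.dvd_of_dvd_pow this
  have hnf : (n : ℤ) ∣ f := dvd_of_forall_prime_dvd h.sqf_n fun q hq hqn => (key q hq hqn).2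
  have hne : (n : ℤ) ∣ e := dvd_of_forall_prime_dvd h.sqf_n fun q hq hqn => (key q hq hqn).1
  have hde : (d : ℤ) ∣ e := by
    have : (d : ℤ) ∣ e ^ 2 := by
      have h3 : (d : ℤ) ∣ e ^ 2 + d * f ^ 2 := (Dvd.intro_left _ rfl).trans h2
      exact (dvd_add_left (Dvd.intro _ rfl)).mp h3
    exact ((Int.squarefree_natCast.mpr h.sqf_d).dvd_pow_iff_dvd two_ne_zero).mp this
  refine ⟨?_, ?_⟩
  · rcases h.c_eq with rfl | rfl
    · simpa using hnf
    · have h4 : (4 : ℤ) ∣ e ^ 2 + d * f ^ 2 := by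
        refine Dvd.dvd.trans ?_ h2
        obtain ⟨d', hd'⟩ : 2 ∣ d := by have := h.d_mod; omega
        exact ⟨n * d', by rw [hd']; push_cast; ring⟩
      have h5 := (even_of_sq_add_mul_sq (by have := h.d_mod; omega) h4).2
      have hc : IsCoprime ((2 : ℕ) : ℤ) (n : ℤ) := by
        rw [Nat.isCoprime_iff_coprime, Nat.coprime_two_left, Nat.odd_iff]; exact h.n_odd
      exact hc.mul_dvd (by exact_mod_cast h5) hnf
  · rw [Int.natCast_dvd] at hne hde ⊢
    exact Nat.lcm_dvd hne hde

/-- The hypotheses say that c n √d (x + y√d)² has coordinates l, k in ℤ[√d]. -/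
lemma coords_of_sq_mul (h : Params d n t m c) {x y : ℚ} {k l : ℤ}
    (hk : c * n * (x ^ 2 + d * y ^ 2) = k) (hl : c * n * d * (2 * x * y) = l) :
    ∃ i j : ℤ, x = i ∧ c * n * d * y = Nat.lcm n d * j := by
  -- Here e and f are the coordinates of c n √d (x + y√d), whose square is integral.
  obtain ⟨e, f, he, hf⟩ := int_coords_of_sq h.sqf_d h.d_mod (x := c * n * d * y) (y := c * n * x)
    (k := c * n * d * k) (l := c * n * l)
    (by push_cast; rw [← hk]; ring) (by push_cast; rw [← hl]; ring)
  have h1 : (2 * e * f : ℤ) = c * n * l := by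
    have : (2 * e * f : ℚ) = c * n * l := by rw [← he, ← hf, ← hl]; ring
    exact_mod_cast this
  have h2 : (e ^ 2 + d * f ^ 2 : ℤ) = c * n * d * k := by
    have : (e ^ 2 + d * f ^ 2 : ℚ) = c * n * d * k := by rw [← he, ← hf, ← hk]; ring
    exact_mod_cast this
  obtain ⟨⟨i, hi⟩, ⟨j, hj⟩⟩ := h.dvd_of_mul_dvd (e := e) (f := f) ⟨l, h1⟩ ⟨k, h2⟩
  refine ⟨i, j, ?_, ?_⟩
  · have hcn : (c * n : ℚ) ≠ 0 := by
      have := h.c_pos; have := h.n_pos; positivity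
    apply mul_left_cancel₀ hcn
    rw [hf, hi]; push_cast; ring
  · rw [he, hj]; push_cast; ring

/-- Here k and l are the coordinates of −((x + y√d) α)². Dividing by the unit t + m√d reduces to
`coords_of_sq_mul`. -/
lemma coords_of_sq_mul_unit (h : Params d n t m c) {x y : ℚ} {k l : ℤ}
    (hk : c * n * d * (m * (x ^ 2 + d * y ^ 2) + t * (2 * x * y)) = k)
    (hl : c * n * (t * (x ^ 2 + d * y ^ 2) + m * d * (2 * x * y)) = l) :
    ∃ i j : ℤ, x = i ∧ c * n * d * y = Nat.lcm n d * j := by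
  have hN := h.norm_rat
  refine h.coords_of_sq_mul (k := m * k - t * l) (l := m * d * l - t * k) ?_ ?_
  · push_cast; rw [← hk, ← hl]
    linear_combination (-(c * n * (x ^ 2 + d * y ^ 2)) : ℚ) * hN
  · push_cast; rw [← hk, ← hl]
    linear_combination (-(c * n * d * (2 * x * y)) : ℚ) * hN

/-- The coordinates of an integral element of the quartic field. The hypotheses say that half the
relative trace has double with integral coordinates, and that the relative norm is integral. -/
lemma coords_of_trace_norm (h : Params d n t m c) {a₀ a₁ b₀ b₁ : ℚ} {u v k l : ℤ}
    (hu : 2 * a₀ = u) (hv : 2 * a₁ = v)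
    (hk : a₀ ^ 2 + d * a₁ ^ 2
      + c * n * d * (m * (b₀ ^ 2 + d * b₁ ^ 2) + t * (2 * b₀ * b₁)) = k)
    (hl : 2 * a₀ * a₁ + c * n * (t * (b₀ ^ 2 + d * b₁ ^ 2) + m * d * (2 * b₀ * b₁)) = l) :
    ∃ i₀ i₁ j₀ j₁ : ℤ, a₀ = i₀ ∧ a₁ = i₁ ∧ b₀ = j₀ ∧ c * n * d * b₁ = Nat.lcm n d * j₁ := by
  have hN := h.norm_rat
  obtain ⟨i, j, hi, hj⟩ := h.coords_of_sq_mul_unit (x := 2 * b₀) (y := 2 * b₁)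
    (k := 4 * k - (u ^ 2 + d * v ^ 2)) (l := 4 * l - 2 * u * v)
    (by push_cast; rw [← hu, ← hv, ← hk]; ring) (by push_cast; rw [← hu, ← hv, ← hl]; ring)
  obtain ⟨l', hl'⟩ := h.lcm_even
  -- Eliminating the quadratic part of the norm leaves the cross term 8 c n d b₀ b₁, a multiple of 4
  -- because lcm(n,d) is even. Modulo 4 only u and v survive; with t odd and d ≡ 2 mod 4 both must
  -- be even.
  have h4 : (4 : ℤ) * (m * d * l - t * k - l' * i * j) =
      2 * u * v * m * d - t * (u ^ 2 + d * v ^ 2) := by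
    have : (4 : ℚ) * (m * d * l - t * k - l' * i * j) =
        2 * u * v * m * d - t * (u ^ 2 + d * v ^ 2) := by
      have h5 : (4 * l' * i * j : ℚ) = c * n * d * (8 * b₀ * b₁) := by
        have : (Nat.lcm n d : ℚ) = 2 * l' := by exact_mod_cast hl'
        rw [this] at hj
        rw [← hi]
        linear_combination (-4 * b₀) * hj
      rw [← hu, ← hv, ← hk, ← hl]
      linear_combination (-1 : ℚ) * h5 + c * n * d * (8 * b₀ * b₁) * hN
    exact_mod_cast this
  obtain ⟨⟨u', rfl⟩, ⟨v', rfl⟩⟩ : 2 ∣ u ∧ 2 ∣ v := by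
    have hd4 := h.d_mod
    have ht := h.t_odd
    obtain ⟨δ, hδ⟩ : ∃ j : ℤ, (d : ℤ) = 4 * j + 2 := ⟨d / 4, by omega⟩
    have h6 : (4 : ℤ) ∣ t * ((u ^ 2 + d * v ^ 2) - 2 * t * (u * v * m * d)) := by
      obtain ⟨s, hs⟩ : ∃ s : ℤ, (t : ℤ) ^ 2 = 4 * s + 1 := by
        obtain ⟨s, hs⟩ : ∃ s : ℤ, (t : ℤ) = 2 * s + 1 := ⟨t / 2, by omega⟩
        exact ⟨s ^ 2 + s, by rw [hs]; ring⟩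
      refine ⟨-(m * d * l - t * k - l' * i * j) - 2 * s * u * v * m * d, ?_⟩
      linear_combination h4 - 2 * u * v * m * d * hs
    have h7 : (4 : ℤ) ∣ (u ^ 2 + d * v ^ 2) - 2 * t * (u * v * m * d) := by
      refine IsCoprime.dvd_of_dvd_mul_left ?_ h6
      have : IsCoprime ((2 ^ 2 : ℕ) : ℤ) (t : ℤ) := by
        rw [Nat.isCoprime_iff_coprime]
        exact Nat.Coprime.pow_left _ ((Nat.coprime_two_left).mpr (Nat.odd_iff.mpr ht))
      exact_mod_cast this
    apply even_of_sq_add_mul_sq (d := d) (by omega)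
    have h8 : (4 : ℤ) ∣ 2 * t * (u * v * m * d) :=
      ⟨t * u * v * m * (2 * δ + 1), by rw [hδ]; ring⟩
    have := dvd_add h7 h8
    rwa [sub_add_cancel] at this
  push_cast at hu hv
  have hu' : a₀ = u' := by linarith
  have hv' : a₁ = v' := by linarith
  obtain ⟨i', j', hi', hj'⟩ := h.coords_of_sq_mul_unit (x := b₀) (y := b₁)
    (k := k - (u' ^ 2 + d * v' ^ 2)) (l := l - 2 * u' * v')
    (by push_cast; rw [← hu', ← hv', ← hk]; ring) (by push_cast; rw [← hu', ← hv', ← hl]; ring)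
  exact ⟨u', v', i', j', hu', hv', hi', hj'⟩

end Params

end QuarticCM

/-! ### The quartic field ℚ(√d, α) -/

namespace QuarticCM

open NumberField

/-- `K` is generated over `ℚ` by `r = √d` and a square root `α` of `-c n r (t + m r)`. -/
structure Gen {K : Type*} [Field K] [NumberField K] (d n t m c : ℕ) (r α : K) : Prop
    extends Params d n t m c where
  sq_r : r ^ 2 = d
  sq_α : α ^ 2 = -(c * n * r * (t + m * r))
  span : ∀ z : K, ∃ x₀ x₁ x₂ x₃ : ℚ, z = x₀ + x₁ * r + (x₂ + x₃ * r) * α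

namespace Gen

variable {K : Type*} [Field K] [NumberField K] {d n t m c : ℕ} {r α : K}

lemma norm_cast (G : Gen d n t m c r α) : (d * m ^ 2 - t ^ 2 : K) = 1 := by
  exact_mod_cast congrArg (Rat.cast : ℚ → K) G.norm_rat

lemma r_ne_zero (G : Gen d n t m c r α) : r ≠ 0 := by
  rintro rfl
  have h := G.sq_r
  have := G.d_pos
  rw [zero_pow two_ne_zero] at h
  have : (d : K) ≠ 0 := by exact_mod_cast this.ne'
  exact this h.symm

lemma cn_ne_zero (G : Gen d n t m c r α) : (c * n : K) ≠ 0 := by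
  have h1 := G.c_pos; have h2 := G.n_pos
  exact_mod_cast (Nat.mul_pos h1 h2).ne'

lemma α_ne_zero (G : Gen d n t m c r α) : α ≠ 0 := by
  rintro rfl
  have h := G.sq_α
  rw [zero_pow two_ne_zero, eq_comm, neg_eq_zero] at h
  rcases mul_eq_zero.mp h with h | h
  · exact mul_ne_zero G.cn_ne_zero G.r_ne_zero h
  · have h1 : (t + m * r) * (m * r - t) = 1 := by
      linear_combination (m ^ 2 : K) * G.sq_r + G.norm_cast
    rw [h, zero_mul] at h1
    exact zero_ne_one h1

lemma add_mul_r_eq_zero (G : Gen d n t m c r α) {x y : ℚ} (h : (x + y * r : K) = 0) :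
    x = 0 ∧ y = 0 := by
  apply G.coords_eq_zero
  have : (x ^ 2 : K) = d * y ^ 2 := by
    linear_combination (x - y * r) * h + y ^ 2 * G.sq_r
  exact_mod_cast this

lemma add_mul_r_inj (G : Gen d n t m c r α) {x y x' y' : ℚ}
    (h : (x + y * r : K) = x' + y' * r) : x = x' ∧ y = y' := by
  have := G.add_mul_r_eq_zero (x := x - x') (y := y - y') (by push_cast; linear_combination h)
  exact ⟨sub_eq_zero.mp this.1, sub_eq_zero.mp this.2⟩

/-! ### Galois group and trace form -/

section Galois

lemma exists_aut [IsGalois ℚ K] (G : Gen d n t m c r α) : ∃ σ : K ≃ₐ[ℚ] K, σ r = -r := by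
  by_contra! hne
  have hfix : ∀ σ : K ≃ₐ[ℚ] K, σ r = r := by
    intro σ
    have : (σ r) ^ 2 = r ^ 2 := by rw [← map_pow, G.sq_r, map_natCast]
    exact (sq_eq_sq_iff_eq_or_eq_neg.mp this).resolve_right (hne σ)
  have hbot : r ∈ (⊥ : IntermediateField ℚ K) := (IsGalois.mem_bot_iff_fixed r).mpr hfix
  obtain ⟨q, hq⟩ := IntermediateField.mem_bot.mp hbot
  apply G.not_sq q
  have : ((q ^ 2 : ℚ) : K) = ((d : ℚ) : K) := by
    push_cast
    rw [← G.sq_r, ← hq]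
    rfl
  exact_mod_cast this

variable {σ : K ≃ₐ[ℚ] K}

/-- The norm of α² to ℚ is c² n² d because t + m√d has norm −1, and this equals (c n √d)². -/
lemma aut_mul (G : Gen d n t m c r α) (hσ : σ r = -r) :
    α * σ α = c * n * r ∨ α * σ α = -(c * n * r) := by
  apply sq_eq_sq_iff_eq_or_eq_neg.mp
  have h : σ α ^ 2 = -(c * n * (-r) * (t + m * (-r))) := by
    rw [← map_pow, G.sq_α]
    simp [hσ]
  rw [mul_pow, h, G.sq_α]
  linear_combination (c ^ 2 * n ^ 2 * r ^ 2 : K) * (m ^ 2 * G.sq_r + G.norm_cast)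

/-- Applying σ to α σ(α) = ± c n √d flips the sign of the right side. Hence σ has order 4 and the
group is cyclic, not a Klein group. -/
lemma aut_sq (G : Gen d n t m c r α) (hσ : σ r = -r) : σ (σ α) = -α := by
  have h0 : σ α ≠ 0 := by simpa using G.α_ne_zero
  apply mul_left_cancel₀ h0
  rcases G.aut_mul hσ with h | h
  · have h' := congrArg σ h
    simp only [map_mul, map_natCast, hσ] at h'
    linear_combination h' + h
  · have h' := congrArg σ h
    simp only [map_mul, map_natCast, map_neg, hσ] at h'
    linear_combination h' + h

lemma aut_aut_coords (G : Gen d n t m c r α) (hσ : σ r = -r) (x₀ x₁ x₂ x₃ : ℚ) :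
    σ (σ (x₀ + x₁ * r + (x₂ + x₃ * r) * α)) = x₀ + x₁ * r - (x₂ + x₃ * r) * α := by
  simp only [map_add, map_mul, map_ratCast, hσ, map_neg, G.aut_sq hσ]
  ring

variable [IsGalois ℚ K]

lemma coords_eq_zero_of_eq_zero (G : Gen d n t m c r α) {x₀ x₁ x₂ x₃ : ℚ}
    (h : (x₀ + x₁ * r + (x₂ + x₃ * r) * α : K) = 0) :
    x₀ = 0 ∧ x₁ = 0 ∧ x₂ = 0 ∧ x₃ = 0 := by
  obtain ⟨σ, hσ⟩ := G.exists_aut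
  have h' := G.aut_aut_coords hσ x₀ x₁ x₂ x₃
  rw [h, map_zero, map_zero] at h'
  have ha : (x₀ + x₁ * r : K) = 0 := by linear_combination (h - h') / 2
  have hb : (x₂ + x₃ * r : K) = 0 := by
    refine (mul_eq_zero.mp (?_ : (x₂ + x₃ * r : K) * α = 0)).resolve_right G.α_ne_zero
    linear_combination h - ha
  obtain ⟨h0, h1⟩ := G.add_mul_r_eq_zero ha
  obtain ⟨h2, h3⟩ := G.add_mul_r_eq_zero hb
  exact ⟨h0, h1, h2, h3⟩

lemma finrank_eq (G : Gen d n t m c r α) : Module.finrank ℚ K = 4 := by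
  have hli : LinearIndependent ℚ ![1, r, α, r * α] := by
    rw [Fintype.linearIndependent_iff]
    intro g hg
    simp only [Fin.sum_univ_four, Algebra.smul_def] at hg
    have := G.coords_eq_zero_of_eq_zero (x₀ := g 0) (x₁ := g 1) (x₂ := g 2) (x₃ := g 3) (by
      rw [← hg]; simp; ring)
    intro i
    fin_cases i
    exacts [this.1, this.2.1, this.2.2.1, this.2.2.2]
  have hsp : ⊤ ≤ Submodule.span ℚ (Set.range ![1, r, α, r * α]) := by
    intro z _
    obtain ⟨x₀, x₁, x₂, x₃, rfl⟩ := G.span z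
    rw [Submodule.mem_span_range_iff_exists_fun]
    refine ⟨![x₀, x₁, x₂, x₃], ?_⟩
    simp [Fin.sum_univ_four, Algebra.smul_def]
    ring
  simpa using Module.finrank_eq_card_basis (Module.Basis.mk hli hsp)

lemma isCyclic (G : Gen d n t m c r α) : IsCyclic (K ≃ₐ[ℚ] K) := by
  obtain ⟨σ, hσ⟩ := G.exists_aut
  have hcard : Nat.card (K ≃ₐ[ℚ] K) = 4 := by
    rw [IsGalois.card_aut_eq_finrank, G.finrank_eq]
  apply isCyclic_of_orderOf_eq_card σ
  rw [hcard]
  refine orderOf_eq_prime_pow (p := 2) (n := 1) ?_ ?_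
  · intro h
    have h1 : σ (σ α) = α := by
      rw [pow_one] at h
      have := DFunLike.congr_fun h α
      simpa [sq] using this
    rw [G.aut_sq hσ] at h1
    exact G.α_ne_zero (self_eq_neg.mp h1.symm)
  · rw [show 2 ^ (1 + 1) = Nat.card (K ≃ₐ[ℚ] K) by rw [hcard]; norm_num]
    exact pow_card_eq_one'

lemma trace_coords (G : Gen d n t m c r α) (x₀ x₁ x₂ x₃ : ℚ) :
    Algebra.trace ℚ K (x₀ + x₁ * r + (x₂ + x₃ * r) * α) = 4 * x₀ := by
  obtain ⟨σ, hσ⟩ := G.exists_aut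
  have h1 : Algebra.trace ℚ K (x₁ * r) = 0 := by
    have := Algebra.trace_eq_of_algEquiv σ (x₁ * r)
    rw [map_mul, map_ratCast, hσ, mul_neg, map_neg] at this
    linarith
  have h2 : Algebra.trace ℚ K ((x₂ + x₃ * r) * α) = 0 := by
    have := Algebra.trace_eq_of_algEquiv (σ.trans σ) ((x₂ + x₃ * r) * α)
    have h3 := G.aut_aut_coords hσ 0 0 x₂ x₃
    simp only [Rat.cast_zero, zero_mul, zero_add, zero_sub] at h3
    rw [AlgEquiv.trans_apply, h3, map_neg] at this
    linarith
  have h0 : Algebra.trace ℚ K (x₀ : K) = 4 * x₀ := by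
    have := Algebra.trace_algebraMap (R := ℚ) (S := K) x₀
    rw [G.finrank_eq] at this
    simpa using this
  rw [map_add, map_add, h0, h1, h2]
  ring

lemma trace_mul (G : Gen d n t m c r α) (x₀ x₁ x₂ x₃ y₀ y₁ y₂ y₃ : ℚ) :
    Algebra.trace ℚ K ((x₀ + x₁ * r + (x₂ + x₃ * r) * α) * (y₀ + y₁ * r + (y₂ + y₃ * r) * α)) =
      4 * (x₀ * y₀ + d * x₁ * y₁
        - c * n * d * (m * (x₂ * y₂ + d * x₃ * y₃) + t * (x₂ * y₃ + x₃ * y₂))) := by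
  rw [← G.trace_coords _ (x₀ * y₁ + x₁ * y₀
      - c * n * (t * (x₂ * y₂ + d * x₃ * y₃) + m * d * (x₂ * y₃ + x₃ * y₂)))
    (x₀ * y₂ + d * x₁ * y₃ + x₂ * y₀ + d * x₃ * y₁) (x₀ * y₃ + x₁ * y₂ + x₂ * y₁ + x₃ * y₀)]
  congr 1
  push_cast
  linear_combination ((x₂ + x₃ * r) * (y₂ + y₃ * r)) * G.sq_α
    + (x₁ * y₁ + (x₁ * y₃ + x₃ * y₁) * α - c * n * m * (x₂ * y₂ + d * x₃ * y₃)
      - c * n * t * (x₂ * y₃ + x₃ * y₂) - c * n * r * (m * (x₂ * y₃ + x₃ * y₂) + t * x₃ * y₃)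
      - c * n * m * r ^ 2 * x₃ * y₃) * G.sq_r

end Galois

/-- In any real embedding −α² would be c n (m d ± t√d), which is positive since t² < d m². -/
lemma isTotallyComplex (G : Gen d n t m c r α) : IsTotallyComplex K := by
  refine ⟨fun w => ?_⟩
  rw [← InfinitePlace.not_isReal_iff_isComplex, InfinitePlace.isReal_iff,
    ComplexEmbedding.isReal_iff]
  intro hw
  set φ := w.embedding
  have hreal : ∀ z, ∃ x : ℝ, φ z = x := fun z =>
    Complex.conj_eq_iff_real.mp (by
      have := RingHom.congr_fun hw z
      simpa [ComplexEmbedding.conjugate_coe_eq] using this)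
  obtain ⟨x, hx⟩ := hreal r
  obtain ⟨y, hy⟩ := hreal α
  have h1 : x ^ 2 = d := by
    have := congrArg φ G.sq_r
    rw [map_pow, hx, map_natCast] at this
    exact_mod_cast this
  have h2 : y ^ 2 = -(c * n * x * (t + m * x)) := by
    have := congrArg φ G.sq_α
    simp only [map_pow, map_neg, map_mul, map_add, map_natCast, hx, hy] at this
    exact_mod_cast this
  have hN : (d * m ^ 2 - t ^ 2 : ℝ) = 1 := by
    exact_mod_cast congrArg (Rat.cast : ℚ → ℝ) G.norm_rat
  have hd : (0 : ℝ) < d := by exact_mod_cast G.d_pos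
  have hcn : (0 : ℝ) < c * n := by exact_mod_cast Nat.mul_pos G.c_pos G.n_pos
  have h3 : 0 < m * d + t * x := by
    have h4 : |t * x| < m * d := by
      apply abs_lt_of_sq_lt_sq _ (by positivity)
      rw [mul_pow, mul_pow, h1]
      nlinarith
    have := (abs_lt.mp h4).1
    linarith
  have h5 := mul_pos hcn h3
  have h6 : y ^ 2 = -(c * n * (m * d + t * x)) := by
    linear_combination h2 - c * n * m * h1
  linarith [sq_nonneg y]

/-! ### Integral elements -/

section Integral

lemma quad_int [IsGalois ℚ K] (G : Gen d n t m c r α) {x y : ℚ}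
    (h : IsIntegral ℤ (x + y * r : K)) : ∃ i j : ℤ, x = i ∧ y = j := by
  obtain ⟨σ, hσ⟩ := G.exists_aut
  have h' : IsIntegral ℤ (x - y * r : K) := by
    have := h.map (σ.toAlgHom.restrictScalars ℤ)
    simpa [hσ, sub_eq_add_neg] using this
  have key : ∀ q : ℚ, IsIntegral ℤ (q : K) → ∃ k : ℤ, q = k := by
    intro q hq
    have : IsIntegral ℤ q := by
      rw [← isIntegral_algebraMap_iff (algebraMap ℚ K).injective]
      simpa using hq
    obtain ⟨j, hj⟩ := IsIntegrallyClosed.isIntegral_iff.mp this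
    exact ⟨j, by simpa using hj.symm⟩
  obtain ⟨k, hk⟩ := key (2 * x) (by
    have e : ((2 * x : ℚ) : K) = (x + y * r) + (x - y * r) := by push_cast; ring
    exact e ▸ h.add h')
  obtain ⟨l, hl⟩ := key (x ^ 2 - d * y ^ 2) (by
    have e : ((x ^ 2 - d * y ^ 2 : ℚ) : K) = (x + y * r) * (x - y * r) := by
      push_cast; linear_combination (y ^ 2 : K) * G.sq_r
    exact e ▸ h.mul h')
  exact int_coords_of_trace_norm G.sqf_d G.d_mod hk hl

lemma coords_of_isIntegral [IsGalois ℚ K] (G : Gen d n t m c r α) {x₀ x₁ x₂ x₃ : ℚ}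
    (h : IsIntegral ℤ (x₀ + x₁ * r + (x₂ + x₃ * r) * α)) :
    ∃ i₀ i₁ i₂ i₃ : ℤ, x₀ = i₀ ∧ x₁ = i₁ ∧ x₂ = i₂ ∧ c * n * d * x₃ = Nat.lcm n d * i₃ := by
  obtain ⟨σ, hσ⟩ := G.exists_aut
  have h' : IsIntegral ℤ (x₀ + x₁ * r - (x₂ + x₃ * r) * α) := by
    rw [← G.aut_aut_coords hσ]
    exact (h.map (σ.toAlgHom.restrictScalars ℤ)).map (σ.toAlgHom.restrictScalars ℤ)
  -- The relative trace and norm to ℚ(√d) are integral there, so their coordinates are integers.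
  obtain ⟨u, v, hu, hv⟩ := G.quad_int (x := 2 * x₀) (y := 2 * x₁) (by
    refine (congrArg (IsIntegral ℤ) ?_).mpr (h.add h')
    push_cast
    ring)
  obtain ⟨k, l, hk, hl⟩ := G.quad_int (x := x₀ ^ 2 + d * x₁ ^ 2
      + c * n * d * (m * (x₂ ^ 2 + d * x₃ ^ 2) + t * (2 * x₂ * x₃)))
      (y := 2 * x₀ * x₁ + c * n * (t * (x₂ ^ 2 + d * x₃ ^ 2) + m * d * (2 * x₂ * x₃))) (by
    refine (congrArg (IsIntegral ℤ) ?_).mpr (h.mul h')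
    push_cast
    linear_combination ((x₂ + x₃ * r) ^ 2 : K) * G.sq_α - (x₁ ^ 2
      + c * n * (m * (x₂ ^ 2 + d * x₃ ^ 2) + t * (2 * x₂ * x₃)
      + r * (2 * m * x₂ * x₃ + t * x₃ ^ 2) + m * r ^ 2 * x₃ ^ 2)) * G.sq_r)
  exact G.coords_of_trace_norm hu hv hk hl

lemma isIntegral_r (G : Gen d n t m c r α) : IsIntegral ℤ r := by
  apply IsIntegral.of_pow (n := 2) (by norm_num)
  rw [G.sq_r]
  exact isIntegral_natCast d

lemma isIntegral_α (G : Gen d n t m c r α) : IsIntegral ℤ α := by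
  apply IsIntegral.of_pow (n := 2) (by norm_num)
  rw [G.sq_α]
  exact ((((isIntegral_natCast c).mul (isIntegral_natCast n)).mul G.isIntegral_r).mul
    ((isIntegral_natCast t).add ((isIntegral_natCast m).mul G.isIntegral_r))).neg

lemma isIntegral_rα (G : Gen d n t m c r α) :
    IsIntegral ℤ (((Nat.lcm n d / (c * n * d) : ℚ) : K) * r * α) := by
  apply IsIntegral.of_pow (n := 2) (by norm_num)
  obtain ⟨w, hw⟩ := G.dvd_lcm_sq
  have hd : (d : K) ≠ 0 := by exact_mod_cast G.d_pos.ne'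
  have hcn := G.cn_ne_zero
  have hw' : (Nat.lcm n d : K) ^ 2 = c * n * d * w := by exact_mod_cast hw
  have : (((Nat.lcm n d / (c * n * d) : ℚ) : K) * r * α) ^ 2 = -(w * (t * r + m * d)) := by
    rw [mul_pow, mul_pow, G.sq_α, G.sq_r]
    push_cast
    rw [div_pow, hw']
    obtain ⟨hc, hn⟩ := mul_ne_zero_iff.mp hcn
    field_simp
    linear_combination (-w * m : K) * G.sq_r
  rw [this]
  exact ((isIntegral_natCast w).mul (((isIntegral_natCast t).mul G.isIntegral_r).add
    ((isIntegral_natCast m).mul (isIntegral_natCast d)))).neg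

end Integral

end Gen

end QuarticCM

namespace QuarticCM

open NumberField

namespace Gen

variable {K : Type*} [Field K] [NumberField K] {d n t m c : ℕ} {r α : K}

/-! ### Integral basis and discriminant -/

section Discriminant

/-- The trace matrix is block diagonal, and its lower block has determinant 16 (c n d ρ)² (d m² −
t²). Both c n d ρ = lcm(n,d) and d m² − t² = 1 are free of c. -/
lemma disc_eq [IsGalois ℚ K] (G : Gen d n t m c r α) : discr K = 256 * d * Nat.lcm n d ^ 2 := by
  set ρ : ℚ := Nat.lcm n d / (c * n * d) with hρ
  have hd : (d : ℚ) ≠ 0 := by exact_mod_cast G.d_pos.ne'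
  have hc : (c : ℚ) ≠ 0 := by exact_mod_cast G.c_pos.ne'
  have hn : (n : ℚ) ≠ 0 := by exact_mod_cast G.n_pos.ne'
  have hl : (Nat.lcm n d : ℚ) ≠ 0 := by
    exact_mod_cast (Nat.lcm_pos G.n_pos G.d_pos).ne'
  have hρ0 : ρ ≠ 0 := by rw [hρ]; positivity
  let b : Fin 4 → 𝓞 K := ![1, ⟨r, G.isIntegral_r⟩, ⟨α, G.isIntegral_α⟩,
    ⟨(ρ : K) * r * α, G.isIntegral_rα⟩]
  let x : Fin 4 → Fin 4 → ℚ := ![![1, 0, 0, 0], ![0, 1, 0, 0], ![0, 0, 1, 0], ![0, 0, 0, ρ]]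
  have hb : ∀ i, (b i : K) = x i 0 + x i 1 * r + (x i 2 + x i 3 * r) * α := by
    intro i
    fin_cases i <;> simp [b, x] <;> rfl
  have hli : LinearIndependent ℤ b := by
    rw [Fintype.linearIndependent_iff]
    intro g hg
    have hg' := congrArg (fun z : 𝓞 K => (z : K)) hg
    simp only [Fin.sum_univ_four, zsmul_eq_mul, map_add, map_mul, map_intCast, hb, map_zero] at hg'
    have := G.coords_eq_zero_of_eq_zero (x₀ := g 0) (x₁ := g 1) (x₂ := g 2) (x₃ := g 3 * ρ) (by
      rw [← hg']; simp [x]; ring)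
    obtain ⟨h0, h1, h2, h3⟩ := this
    have h3 := (mul_eq_zero.mp h3).resolve_right hρ0
    intro i
    fin_cases i
    exacts [by exact_mod_cast h0, by exact_mod_cast h1, by exact_mod_cast h2,
      by exact_mod_cast h3]
  have hsp : ⊤ ≤ Submodule.span ℤ (Set.range b) := by
    intro z _
    obtain ⟨x₀, x₁, x₂, x₃, hz⟩ := G.span (z : K)
    obtain ⟨i₀, i₁, i₂, i₃, h0, h1, h2, h3⟩ := G.coords_of_isIntegral
      (by rw [← hz]; exact RingOfIntegers.isIntegral_coe z)
    have h3' : x₃ = i₃ * ρ := by rw [hρ]; field_simp; linear_combination h3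
    rw [Submodule.mem_span_range_iff_exists_fun]
    refine ⟨![i₀, i₁, i₂, i₃], ?_⟩
    apply RingOfIntegers.ext
    rw [hz, h3']
    subst h0 h1 h2
    simp only [Fin.sum_univ_four, zsmul_eq_mul, map_add, map_mul, map_intCast, hb]
    simp [x]
    ring
  rw [← discr_eq_discr K (Module.Basis.mk hli hsp), Module.Basis.coe_mk, Algebra.discr_def]
  have hT : ∀ i j, ((Algebra.traceMatrix ℤ b i j : ℤ) : ℚ) =
      4 * (x i 0 * x j 0 + d * x i 1 * x j 1
        - c * n * d * (m * (x i 2 * x j 2 + d * x i 3 * x j 3)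
          + t * (x i 2 * x j 3 + x i 3 * x j 2))) := by
    intro i j
    rw [← G.trace_mul, ← hb, ← hb, ← map_mul, Algebra.traceMatrix_apply, Algebra.traceForm_apply,
      Algebra.coe_trace_int]
  have hdet : (((Algebra.traceMatrix ℤ b).det : ℤ) : ℚ) =
      (!![4, 0, 0, 0; 0, 4 * d, 0, 0; 0, 0, -4 * c * n * d * m, -4 * c * n * d * t * ρ;
        0, 0, -4 * c * n * d * t * ρ, -4 * c * n * d * m * d * ρ ^ 2] : Matrix _ _ ℚ).det := by
    rw [Int.cast_det]
    congr 1
    ext i j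
    rw [Matrix.map_apply, hT]
    fin_cases i <;> fin_cases j <;> simp [x] <;> ring
  have hN := G.norm_rat
  have : (((Algebra.traceMatrix ℤ b).det : ℤ) : ℚ) = 256 * d * Nat.lcm n d ^ 2 := by
    have hρ' : ρ * (c * n * d) = Nat.lcm n d := by rw [hρ]; field_simp
    rw [hdet, ← hρ', Matrix.det_succ_row_zero]
    simp [Fin.sum_univ_succ, Matrix.det_succ_row_zero, Fin.succAbove, Matrix.submatrix]
    linear_combination (256 * d * ρ ^ 2 * (c * n * d) ^ 2) * hN
  exact_mod_cast this

end Discriminant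

/-! ### Units lie in the real quadratic subfield -/

section Units

lemma unit_quad [IsGalois ℚ K] (G : Gen d n t m c r α) {x y : ℚ}
    (h0 : (x + y * r : K) ≠ 0) (h : IsIntegral ℤ (x + y * r : K))
    (h' : IsIntegral ℤ (x + y * r : K)⁻¹) :
    ∃ i j : ℤ, x = i ∧ y = j ∧ (i ^ 2 - d * j ^ 2 = 1 ∨ i ^ 2 - d * j ^ 2 = -1) := by
  obtain ⟨i, j, rfl, rfl⟩ := G.quad_int h
  refine ⟨i, j, rfl, rfl, ?_⟩
  set w : ℤ := i ^ 2 - d * j ^ 2 with hw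
  have hwq : (w : ℚ) = i ^ 2 - d * j ^ 2 := by rw [hw]; push_cast; ring
  have hw0 : (w : ℚ) ≠ 0 := by
    intro hw1
    obtain ⟨h1, h2⟩ := G.coords_eq_zero (x := i) (y := j) (by linarith)
    apply h0
    rw [h1, h2]; simp
  have hw0' : (w : K) ≠ 0 := by exact_mod_cast hw0
  have hinv : (((i : ℚ) : K) + ((j : ℚ) : K) * r)⁻¹ =
      ((i / w : ℚ) : K) + ((-j / w : ℚ) : K) * r := by
    apply inv_eq_of_mul_eq_one_right
    push_cast
    field_simp
    rw [hw]
    push_cast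
    linear_combination (-(j : K) ^ 2) * G.sq_r
  rw [hinv] at h'
  obtain ⟨k, l, hk, hl⟩ := G.quad_int h'
  have h1 : (w * (k ^ 2 - d * l ^ 2) : ℤ) = 1 := by
    have : (w * (k ^ 2 - d * l ^ 2) : ℚ) = 1 := by
      rw [← hk, ← hl]
      field_simp
      rw [hwq]
    exact_mod_cast this
  exact Int.isUnit_iff.mp (IsUnit.of_mul_eq_one _ h1)

/-- Every unit of the ring of integers lies in the real quadratic subfield. -/
lemma unit_coords [IsGalois ℚ K] (G : Gen d n t m c r α) {z : K}
    (h0 : z ≠ 0) (h : IsIntegral ℤ z) (h' : IsIntegral ℤ z⁻¹) :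
    ∃ i j : ℤ, z = i + j * r ∧ (i ^ 2 - d * j ^ 2 = 1 ∨ i ^ 2 - d * j ^ 2 = -1) := by
  obtain ⟨σ, hσ⟩ := G.exists_aut
  obtain ⟨τ, hτ⟩ : ∃ τ : K ≃ₐ[ℚ] K, ∀ z, τ z = σ (σ z) := ⟨σ.trans σ, fun _ => rfl⟩
  have hτ' : ∀ x₀ x₁ x₂ x₃ : ℚ, τ (x₀ + x₁ * r + (x₂ + x₃ * r) * α) =
      x₀ + x₁ * r - (x₂ + x₃ * r) * α := fun x₀ x₁ x₂ x₃ => by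
    rw [hτ, G.aut_aut_coords hσ]
  have hττ : ∀ z, τ (τ z) = z := by
    intro z
    obtain ⟨x₀, x₁, x₂, x₃, rfl⟩ := G.span z
    have := hτ' x₀ x₁ (-x₂) (-x₃)
    rw [hτ', sub_eq_add_neg, ← neg_mul, neg_add, ← neg_mul]
    push_cast at this
    rw [this]
    ring
  have hm : (0 : ℚ) < m := by
    have : m ≠ 0 := by
      rintro rfl
      have := G.norm
      simp at this
    exact_mod_cast Nat.pos_of_ne_zero this
  have hN := G.norm_rat
  have hd : (0 : ℚ) < d := by exact_mod_cast G.d_pos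
  have hcn : (0 : ℚ) < c * n := by exact_mod_cast Nat.mul_pos G.c_pos G.n_pos
  have hτz : τ z ≠ 0 := by simpa using h0
  -- With τ = σ² playing complex conjugation, ζ = z/τ(z) is integral of relative norm 1. The aim is
  -- ζ = ±1.
  obtain ⟨a₀, a₁, b₀, b₁, hζ⟩ := G.span (z * (τ z)⁻¹)
  have hζ1 : (z * (τ z)⁻¹) * τ (z * (τ z)⁻¹) = 1 := by
    rw [map_mul, map_inv₀, hττ]
    field_simp
  have hζi : IsIntegral ℤ (z * (τ z)⁻¹) := by
    apply h.mul
    rw [← map_inv₀]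
    exact h'.map (τ.toAlgHom.restrictScalars ℤ)
  rw [hζ] at hζi hζ1
  rw [hτ'] at hζ1
  obtain ⟨e, f, -, -, rfl, rfl, -, -⟩ := G.coords_of_isIntegral hζi
  obtain ⟨H0, H1⟩ := G.add_mul_r_inj (x := e ^ 2 + d * f ^ 2
      + c * n * d * (m * (b₀ ^ 2 + d * b₁ ^ 2) + t * (2 * b₀ * b₁)))
      (y := 2 * e * f + c * n * (t * (b₀ ^ 2 + d * b₁ ^ 2) + m * d * (2 * b₀ * b₁)))
      (x' := 1) (y' := 0) (by
    push_cast at hζ1 ⊢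
    linear_combination hζ1 + ((b₀ + b₁ * r) ^ 2 : K) * G.sq_α - (f ^ 2
      + c * n * (m * (b₀ ^ 2 + d * b₁ ^ 2) + t * (2 * b₀ * b₁)
      + r * (2 * m * b₀ * b₁ + t * b₁ ^ 2) + m * r ^ 2 * b₁ ^ 2)) * G.sq_r)
  -- c n d W is the rational part of −((b₀ + b₁√d) α)², a totally nonnegative element. The rational
  -- part of ζ τ(ζ) = 1 thus bounds e² + d f² by 1.
  set W : ℚ := m * (b₀ ^ 2 + d * b₁ ^ 2) + t * (2 * b₀ * b₁) with hW
  have hmW : m * W = (m * b₀ + t * b₁) ^ 2 + b₁ ^ 2 := by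
    rw [hW]; linear_combination b₁ ^ 2 * hN
  have hW0 : 0 ≤ W := by
    have : 0 ≤ m * W := by rw [hmW]; positivity
    exact nonneg_of_mul_nonneg_right this hm
  have hle : e ^ 2 + d * f ^ 2 ≤ 1 := by
    have : (e ^ 2 + d * f ^ 2 : ℚ) ≤ 1 := by
      have : 0 ≤ c * n * d * W := by positivity
      linarith
    exact_mod_cast this
  have hd2 : (2 : ℤ) < d := by exact_mod_cast G.two_lt
  have hf : f = 0 := by
    by_contra hf
    have : 0 < f ^ 2 := by positivity
    nlinarith [sq_nonneg e]
  subst hf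
  have he : e ^ 2 = 0 ∨ e ^ 2 = 1 := by
    have : 0 ≤ e ^ 2 := sq_nonneg e
    simp only [ne_eq, OfNat.ofNat_ne_zero, not_false_eq_true, zero_pow, mul_zero, add_zero] at hle
    omega
  rcases he with he | he
  · exfalso
    have he : e = 0 := by simpa using he
    subst he
    -- If e = 0, then c n √d ε (b₀ + b₁√d)² = 1. Taking norms to ℚ makes d times a rational square
    -- equal to 1.
    apply G.mul_sq_ne_one (c * n * (b₀ ^ 2 - d * b₁ ^ 2))
    · simp only [Int.cast_zero] at H0 H1
      have e1 : c * n * (t * (b₀ ^ 2 + d * b₁ ^ 2) + m * d * (2 * b₀ * b₁)) = 0 := by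
        linear_combination H1
      have e2 : c * n * d * W = 1 := by linear_combination H0
      have e3 : (c * n * d * W) ^ 2
          - d * (c * n * (t * (b₀ ^ 2 + d * b₁ ^ 2) + m * d * (2 * b₀ * b₁))) ^ 2 =
          d * (c * n * (b₀ ^ 2 - d * b₁ ^ 2)) ^ 2 := by
        rw [hW]
        linear_combination
          d * (c * n) ^ 2 * ((b₀ ^ 2 + d * b₁ ^ 2) ^ 2 - d * (2 * b₀ * b₁) ^ 2) * hN
      rw [← e3, e1, e2]; ring
  · have heq : (e : ℚ) ^ 2 = 1 := by exact_mod_cast he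
    have hW1 : W = 0 := by
      have h3 : c * n * d * W = 0 := by
        simp only [Int.cast_zero] at H0
        linear_combination H0 - heq
      exact (mul_eq_zero.mp h3).resolve_left (by positivity)
    have hb1 : b₁ = 0 := by
      rw [hW1] at hmW
      nlinarith [sq_nonneg (m * b₀ + t * b₁)]
    have hb0 : b₀ = 0 := by
      rw [hW1, hb1] at hmW
      have : (m * b₀) ^ 2 = 0 := by linear_combination -hmW
      have := pow_eq_zero_iff (two_ne_zero) |>.mp this
      exact (mul_eq_zero.mp this).resolve_left hm.ne'
    have hz : z = e * τ z := by
      rw [hb0, hb1] at hζ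
      rw [← div_eq_mul_inv, div_eq_iff hτz] at hζ
      push_cast at hζ
      linear_combination hζ
    obtain ⟨x₀, x₁, x₂, x₃, rfl⟩ := G.span z
    rw [hτ'] at hz
    rcases (sq_eq_sq_iff_eq_or_eq_neg.mp (he.trans (one_pow 2).symm)) with rfl | rfl
    · obtain ⟨-, -, h2, h3⟩ := G.coords_eq_zero_of_eq_zero (x₀ := 0) (x₁ := 0) (x₂ := x₂)
        (x₃ := x₃) (by push_cast at hz ⊢; linear_combination hz / 2)
      subst h2 h3
      simp only [Rat.cast_zero, zero_mul, add_zero] at h0 h h'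
      obtain ⟨i, j, rfl, rfl, hij⟩ := G.unit_quad h0 h h'
      exact ⟨i, j, by simp, hij⟩
    · exfalso
      obtain ⟨h1, h2, -, -⟩ := G.coords_eq_zero_of_eq_zero (x₀ := x₀) (x₁ := x₁) (x₂ := 0)
        (x₃ := 0) (by push_cast at hz ⊢; linear_combination hz / 2)
      subst h1 h2
      -- If τ(z) = −z, then z² is a unit of ℤ[√d] whose norm is d times a rational square: it cannot
      -- be 1 by irrationality, nor −1 by sign.
      have hsq : ((0 : ℚ) + (0 : ℚ) * r + (x₂ + x₃ * r) * α) ^ 2 =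
          ((-(c * n * d * (m * (x₂ ^ 2 + d * x₃ ^ 2) + t * (2 * x₂ * x₃))) : ℚ) : K)
          + ((-(c * n * (t * (x₂ ^ 2 + d * x₃ ^ 2) + m * d * (2 * x₂ * x₃))) : ℚ) : K) * r := by
        push_cast
        linear_combination ((x₂ + x₃ * r) ^ 2 : K) * G.sq_α - (
          c * n * (m * (x₂ ^ 2 + d * x₃ ^ 2) + t * (2 * x₂ * x₃)
          + r * (2 * m * x₂ * x₃ + t * x₃ ^ 2) + m * r ^ 2 * x₃ ^ 2)) * G.sq_r
      obtain ⟨i, j, hi, hj, hij⟩ := G.unit_quad (hsq ▸ pow_ne_zero 2 h0) (hsq ▸ h.pow 2)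
        (by rw [← hsq, ← inv_pow]; exact h'.pow 2)
      have h3 : d * (c * n * (x₂ ^ 2 - d * x₃ ^ 2)) ^ 2 = (i ^ 2 - d * j ^ 2 : ℚ) := by
        rw [← hi, ← hj]
        linear_combination
          -(d * (c * n) ^ 2 * ((x₂ ^ 2 + d * x₃ ^ 2) ^ 2 - d * (2 * x₂ * x₃) ^ 2) * hN)
      rcases hij with hij | hij
      · have h4 : (i ^ 2 - d * j ^ 2 : ℚ) = 1 := by exact_mod_cast hij
        rw [h4] at h3
        exact G.mul_sq_ne_one _ h3
      · have h4 : (i ^ 2 - d * j ^ 2 : ℚ) = -1 := by exact_mod_cast hij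
        rw [h4] at h3
        have : 0 ≤ d * (c * n * (x₂ ^ 2 - d * x₃ ^ 2)) ^ 2 := by positivity
        linarith

end Units

end Gen

end QuarticCM

namespace QuarticCM

open NumberField

/-! ### Regulators in unit rank one, and a lower bound -/

section Regulator

open NumberField.Units NumberField.InfinitePlace

/-- In a totally complex quartic field the logarithms of the units, with respect to any complex
embedding, are the integral multiples of the regulator. -/
lemma exists_unit_log_iff {K : Type*} [Field K] [NumberField K] [IsTotallyComplex K]
    (h4 : Module.finrank ℚ K = 4) (φ : K →+* ℂ) (x : ℝ) :
    (∃ u : (𝓞 K)ˣ, x = 2 * Real.log ‖φ u‖) ↔ ∃ k : ℤ, x = k * regulator K := by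
  classical
  have hcard : Fintype.card (InfinitePlace K) = 2 := by
    have h1 := IsTotallyComplex.finrank K
    have h2 := IsTotallyComplex.nrRealPlaces_eq_zero K
    have h3 := card_eq_nrRealPlaces_add_nrComplexPlaces K
    omega
  have hrank : rank K = 1 := by rw [rank, hcard]
  set w := InfinitePlace.mk φ
  obtain ⟨w', hw'⟩ : ∃ w', w' ≠ w :=
    Fintype.exists_ne_of_one_lt_card (by omega) w
  let e : {v : InfinitePlace K // v ≠ w'} ≃ Fin (rank K) := Fintype.equivOfCardEq (by
    rw [Fintype.card_subtype_compl, Fintype.card_subtype_eq, hcard, Fintype.card_fin, hrank])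
  have : Subsingleton (Fin (rank K)) := by rw [hrank]; infer_instance
  have : Subsingleton {v : InfinitePlace K // v ≠ w'} := e.subsingleton
  set i₀ := e ⟨w, hw'.symm⟩
  -- There are two complex places; omitting one leaves a 1×1 matrix, whose entry carries the
  -- multiplicity 2 of a complex place.
  have hreg : regulator K = |2 * Real.log ‖φ (fundSystem K i₀)‖| := by
    rw [regulator_eq_det K w' e, Matrix.det_eq_elem_of_subsingleton _ ⟨w, hw'.symm⟩]
    simp [IsTotallyComplex.mult_eq, w, i₀, InfinitePlace.apply]
  have hlog : ∀ (ζ : torsion K) (k : ℤ), 2 * Real.log ‖φ ((ζ : (𝓞 K)ˣ) * fundSystem K i₀ ^ k :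
      (𝓞 K)ˣ)‖ = k * (2 * Real.log ‖φ (fundSystem K i₀)‖) := by
    intro ζ k
    have hζ := (mem_torsion K).mp ζ.2 w
    have hζ' : ‖φ ((ζ : (𝓞 K)ˣ) : K)‖ = 1 := by simpa [w, InfinitePlace.apply] using hζ
    rw [NumberField.Units.coe_mul, NumberField.Units.coe_zpow, map_mul, map_zpow₀, norm_mul, hζ', one_mul, norm_zpow, Real.log_zpow]
    ring
  have key : (∃ u : (𝓞 K)ˣ, x = 2 * Real.log ‖φ u‖) ↔
      ∃ k : ℤ, x = k * (2 * Real.log ‖φ (fundSystem K i₀)‖) := by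
    constructor
    · rintro ⟨u, rfl⟩
      obtain ⟨⟨ζ, f⟩, hu, -⟩ := exist_unique_eq_mul_prod K u
      refine ⟨f i₀, ?_⟩
      rw [← hlog ζ, hu]
      simp only
      rw [Fintype.prod_subsingleton _ i₀]
    · rintro ⟨k, rfl⟩
      exact ⟨_, (hlog 1 k).symm⟩
  rw [key, hreg]
  rcases abs_choice (2 * Real.log ‖φ (fundSystem K i₀)‖) with h | h <;> rw [h]
  constructor <;> rintro ⟨k, rfl⟩ <;> exact ⟨-k, by push_cast; ring⟩

lemma eq_of_int_multiples {a b : ℝ} (ha : 0 < a) (hb : 0 < b)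
    (h : ∀ x : ℝ, (∃ k : ℤ, x = k * a) ↔ ∃ k : ℤ, x = k * b) : a = b := by
  obtain ⟨k, hk⟩ := (h a).mp ⟨1, by simp⟩
  obtain ⟨l, hl⟩ := (h b).mpr ⟨1, by simp⟩
  have hk0 : 1 ≤ k := by
    have : (0 : ℝ) < k := pos_of_mul_pos_left (hk ▸ ha) hb.le
    exact_mod_cast this
  have hl0 : 1 ≤ l := by
    have : (0 : ℝ) < l := pos_of_mul_pos_left (hl ▸ hb) ha.le
    exact_mod_cast this
  have hk1 : (1 : ℝ) ≤ k := by exact_mod_cast hk0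
  have hl1 : (1 : ℝ) ≤ l := by exact_mod_cast hl0
  nlinarith

/-- `2 log |i + j √d|` for the units `i + j √d` of `ℤ[√d]`. -/
def quadLogs (d : ℕ) : Set ℝ :=
  {x | ∃ i j : ℤ, (i ^ 2 - d * j ^ 2 = 1 ∨ i ^ 2 - d * j ^ 2 = -1) ∧
    x = 2 * Real.log |i + j * √d|}

/-- If |i + j√d| > 1, its conjugate has absolute value below 1, while the two differ by 2|j|√d ≥
2√d. Hence |i + j√d| ≥ √d. -/
lemma log_le_of_mem_quadLogs {d : ℕ} (hd : 2 < d) {x : ℝ} (hx : x ∈ quadLogs d) (hx0 : 0 < x) :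
    Real.log d ≤ x := by
  obtain ⟨i, j, hij, rfl⟩ := hx
  have hd0 : (2 : ℝ) < d := by exact_mod_cast hd
  have hs : √(d : ℝ) ^ 2 = d := Real.sq_sqrt (by positivity)
  set s := √(d : ℝ)
  set u : ℝ := i + j * s with hu
  have hu1 : 1 < |u| := by
    by_contra hle
    have := Real.log_nonpos (abs_nonneg u) (not_lt.mp hle)
    linarith
  have hprod : |u| * |i - j * s| = 1 := by
    rw [← abs_mul]
    have : u * (i - j * s) = ((i ^ 2 - d * j ^ 2 : ℤ) : ℝ) := by
      push_cast
      linear_combination (-(j : ℝ) ^ 2) * hs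
    rw [this]
    rcases hij with h | h <;> rw [h] <;> simp
  have hv : |i - j * s| < 1 := by
    by_contra hle
    nlinarith [abs_nonneg (i - j * s)]
  have hj : j ≠ 0 := by
    rintro rfl
    simp only [Int.cast_zero, zero_mul, sub_zero, add_zero, hu] at hv hu1
    linarith
  have hj1 : (1 : ℝ) ≤ |j| := by
    rw [← Int.cast_one, Int.cast_le]
    exact Int.one_le_abs hj
  rw [Int.cast_abs] at hj1
  have hs0 : 0 ≤ s := Real.sqrt_nonneg _
  have hs1 : 1 < s := by nlinarith
  have hsum : 2 * s ≤ |u| + |i - j * s| := by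
    have h1 : |u - (i - j * s)| ≤ |u| + |i - j * s| := abs_sub _ _
    have h2 : u - (i - j * s) = 2 * s * j := by rw [hu]; ring
    rw [h2, abs_mul, abs_of_nonneg (by positivity : 0 ≤ 2 * s)] at h1
    nlinarith
  have hge : s ≤ |u| := by linarith
  calc Real.log d = 2 * Real.log s := by rw [← hs, Real.log_pow]; norm_num
    _ ≤ 2 * Real.log |u| := by
      have := Real.log_le_log (by linarith) hge
      linarith

end Regulator

/-- `α` is a complex generator, over `ℚ(√d)`, of the field `K`, with the given parameters. -/
structure CGen (K : NumField) (d n t m c : ℕ) (α : ℂ) : Prop extends Params d n t m c where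
  isGalois : IsGalois ℚ K.1
  r_mem : (√(d : ℝ) : ℂ) ∈ K.1
  α_mem : α ∈ K.1
  sq_α : α ^ 2 = -(c * n * √(d : ℝ) * (t + m * √(d : ℝ)))
  span : ∀ z ∈ K.1, ∃ x₀ x₁ x₂ x₃ : ℚ, z = x₀ + x₁ * √(d : ℝ) + (x₂ + x₃ * √(d : ℝ)) * α

/-! ### Invariants of the subfields of ℂ -/

namespace CGen

variable {K : NumField} {d n t m c : ℕ} {α : ℂ}

lemma sq_sqrt (d : ℕ) : ((√(d : ℝ) : ℝ) : ℂ) ^ 2 = d := by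
  rw [← Complex.ofReal_pow, Real.sq_sqrt (by positivity)]; simp

lemma gen (C : CGen K d n t m c α) :
    Gen (K := K.1) d n t m c ⟨(√(d : ℝ) : ℂ), C.r_mem⟩ ⟨α, C.α_mem⟩ where
  toParams := C.toParams
  sq_r := by
    apply Subtype.ext
    push_cast
    exact sq_sqrt d
  sq_α := by
    apply Subtype.ext
    push_cast
    exact C.sq_α
  span z := by
    obtain ⟨x₀, x₁, x₂, x₃, hz⟩ := C.span z z.2
    refine ⟨x₀, x₁, x₂, x₃, Subtype.ext ?_⟩
    push_cast
    exact hz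

lemma isImaginaryCyclicQuartic (C : CGen K d n t m c α) : IsImaginaryCyclicQuartic K := by
  have := C.isGalois
  exact ⟨C.gen.finrank_eq, C.isGalois, C.gen.isCyclic, C.gen.isTotallyComplex⟩

lemma disc_eq (C : CGen K d n t m c α) : disc K = 256 * d * Nat.lcm n d ^ 2 := by
  have := C.isGalois
  exact C.gen.disc_eq

lemma mem_quadLogs_iff (C : CGen K d n t m c α) (x : ℝ) :
    x ∈ quadLogs d ↔ ∃ k : ℤ, x = k * reg K := by
  have := C.isGalois
  have G := C.gen
  have := G.isTotallyComplex
  rw [reg, ← exists_unit_log_iff G.finrank_eq (algebraMap K.1 ℂ)]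
  constructor
  · rintro ⟨i, j, hij, rfl⟩
    set r : K.1 := ⟨(√(d : ℝ) : ℂ), C.r_mem⟩ with hr
    have hint : ∀ k : ℤ, IsIntegral ℤ (i + k * r) := fun k =>
      (isIntegral_intCast i).add ((isIntegral_intCast k).mul G.isIntegral_r)
    let a : 𝓞 K.1 := ⟨i + j * r, hint j⟩
    let a' : 𝓞 K.1 := ⟨i + (-j : ℤ) * r, hint (-j)⟩
    have haa : a * a' = ((i ^ 2 - d * j ^ 2 : ℤ) : 𝓞 K.1) := by
      apply RingOfIntegers.ext
      change algebraMap (𝓞 K.1) K.1 _ = algebraMap (𝓞 K.1) K.1 _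
      rw [map_mul, map_intCast]
      change (i + j * r) * (i + (-j : ℤ) * r) = _
      push_cast
      linear_combination (-(j : K.1) ^ 2) * G.sq_r
    have hunit : IsUnit a := by
      have : IsUnit (a * a') := by
        rw [haa]
        rcases hij with h | h <;> rw [h] <;> simp
      exact isUnit_of_mul_isUnit_left this
    obtain ⟨u, hu⟩ := hunit
    refine ⟨u, ?_⟩
    rw [hu]
    have : algebraMap K.1 ℂ (a : K.1) = ((i + j * √(d : ℝ) : ℝ) : ℂ) := by
      change algebraMap K.1 ℂ (i + j * r) = _
      rw [map_add, map_mul, map_intCast, map_intCast]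
      push_cast
      rfl
    rw [this, Complex.norm_real, Real.norm_eq_abs]
  · rintro ⟨u, rfl⟩
    obtain ⟨i, j, hz, hij⟩ := G.unit_coords (z := (u : K.1)) (Units.coe_ne_zero u)
      (RingOfIntegers.isIntegral_coe _) (by
        have := RingOfIntegers.isIntegral_coe ((u⁻¹ : (𝓞 K.1)ˣ) : 𝓞 K.1)
        simpa using this)
    refine ⟨i, j, hij, ?_⟩
    rw [hz, map_add, map_mul, map_intCast, map_intCast]
    have : (i : ℂ) + j * algebraMap K.1 ℂ ⟨(√(d : ℝ) : ℂ), C.r_mem⟩ =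
        ((i + j * √(d : ℝ) : ℝ) : ℂ) := by
      push_cast
      rfl
    rw [this, Complex.norm_real, Real.norm_eq_abs]

lemma reg_pos (_C : CGen K d n t m c α) : 0 < reg K := NumberField.Units.regulator_pos K.1

lemma log_le_reg (C : CGen K d n t m c α) : Real.log d ≤ reg K :=
  log_le_of_mem_quadLogs C.two_lt ((C.mem_quadLogs_iff _).mpr ⟨1, by simp⟩) C.reg_pos

/-- Only d has to agree: both regulators generate the group `quadLogs d`. -/
lemma reg_eq {K' : NumField} {n' t' m' c' : ℕ} {α' : ℂ} (C : CGen K d n t m c α)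
    (C' : CGen K' d n' t' m' c' α') : reg K = reg K' :=
  eq_of_int_multiples C.reg_pos C'.reg_pos fun x => by
    rw [← C.mem_quadLogs_iff, ← C'.mem_quadLogs_iff]

/-- Two generators of the same field have a ratio whose square is that of an element of
`ℚ(√d)`; as the ratio is rational, it is a rational square or `d` times one. -/
lemma ratio_eq {n' c' : ℕ} {α' : ℂ} (C : CGen K d n t m c α) (C' : CGen K d n' t m c' α') :
    ∃ x : ℚ, (c * n : ℚ) = c' * n' * x ^ 2 ∨ (c * n : ℚ) = c' * n' * (d * x ^ 2) := by
  have := C.isGalois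
  have G := C.gen
  have G' := C'.gen
  obtain ⟨σ, hσ⟩ := G.exists_aut
  set r : K.1 := ⟨(√(d : ℝ) : ℂ), C.r_mem⟩
  set A : K.1 := ⟨α, C.α_mem⟩
  set A' : K.1 := ⟨α', C'.α_mem⟩
  obtain ⟨x₀, x₁, x₂, x₃, hA⟩ := G'.span A
  have h1 := G'.aut_aut_coords hσ x₀ x₁ x₂ x₃
  rw [← hA, G.aut_sq hσ] at h1
  -- Both generators are negated by σ², so their ratio lies in ℚ(√d).
  have h2 : A = (x₂ + x₃ * r) * A' := by linear_combination (hA - h1) / 2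
  have h3 : (t + m * r) * (m * r - t) = 1 := by
    linear_combination (m ^ 2 : K.1) * G.sq_r + G.norm_cast
  have h4 : (c * n * r : K.1) = c' * n' * r * (x₂ + x₃ * r) ^ 2 := by
    have h5 : A ^ 2 = (x₂ + x₃ * r) ^ 2 * A' ^ 2 := by rw [h2]; ring
    rw [G.sq_α, G'.sq_α] at h5
    linear_combination (-(m * r - t) : K.1) * h5
      - (c * n * r - c' * n' * r * (x₂ + x₃ * r) ^ 2) * h3
  have h6 : (c * n : K.1) = c' * n' * (x₂ + x₃ * r) ^ 2 := by
    apply mul_left_cancel₀ G.r_ne_zero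
    linear_combination h4
  obtain ⟨h7, h8⟩ := G.add_mul_r_inj (x := c * n) (y := 0)
    (x' := c' * n' * (x₂ ^ 2 + d * x₃ ^ 2)) (y' := c' * n' * (2 * x₂ * x₃)) (by
      push_cast
      linear_combination h6 + c' * n' * x₃ ^ 2 * G.sq_r)
  have h9 : (c' * n' : ℚ) ≠ 0 := by
    exact_mod_cast (Nat.mul_pos C'.c_pos C'.n_pos).ne'
  have h10 : x₂ = 0 ∨ x₃ = 0 := by
    have := (mul_eq_zero.mp h8.symm).resolve_left h9
    rw [mul_assoc] at this
    exact mul_eq_zero.mp ((mul_eq_zero.mp this).resolve_left two_ne_zero)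
  rcases h10 with rfl | rfl
  · exact ⟨x₃, Or.inr (by rw [h7]; ring)⟩
  · exact ⟨x₂, Or.inl (by rw [h7]; ring)⟩

end CGen

end QuarticCM

namespace QuarticCM

/-! ### Identification with the splitting fields -/

section Field

variable {d n t m c : ℕ}

lemma Params.m_pos (P : Params d n t m c) : 0 < m := by
  rcases Nat.eq_zero_or_pos m with rfl | h
  · have := P.norm
    simp at this
  · exact h

lemma isGalois_quarticField (s t : ℚ) : IsGalois ℚ (quarticField s t).1 := by
  have : (quarticPoly s t).IsSplittingField ℚ (quarticField s t).1 :=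
    IntermediateField.adjoin_rootSet_isSplittingField (IsAlgClosed.splits _)
  have : Normal ℚ (quarticField s t).1 := Normal.of_isSplittingField (quarticPoly s t)
  exact ⟨⟩

lemma mem_rootSet_quarticPoly {s t : ℚ} (hs : s ≠ 0) (ht : t ≠ 0) (z : ℂ) :
    z ∈ (quarticPoly s t).rootSet ℂ ↔
      z ^ 4 - 2 * s * (t ^ 2 + 1) * z ^ 2 + s ^ 2 * t ^ 2 * (t ^ 2 + 1) = 0 := by
  have h0 : quarticPoly s t ≠ 0 := by
    intro h
    have h1 := congrArg (eval 0) h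
    simp only [quarticPoly, eval_add, eval_sub, eval_pow, eval_X, eval_mul, eval_C, eval_zero] at h1
    have : s ^ 2 * t ^ 2 * (t ^ 2 + 1) ≠ 0 := by positivity
    apply this
    simpa using h1
  rw [mem_rootSet_of_ne h0]
  simp [quarticPoly]

/-- The field generated by a square root of `-c n √d (t + m √d)` is one of the fields `K_{s,t}`. -/
lemma exists_cgen (P : Params d n t m c) {b : ℕ} (hb : 0 < b) {s : ℚ} {p : ℕ}
    (hp : 0 < p) (hn : n * b ^ 2 = p * m) (hs : s * c = -2 * p) :
    ∃ α, CGen (quarticField s t) d n t m c α := by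
  set r : ℂ := (√(d : ℝ) : ℂ) with hr
  have hr2 : r ^ 2 = d := CGen.sq_sqrt d
  obtain ⟨α, hα⟩ : ∃ α : ℂ, α ^ 2 = -(c * n * r * (t + m * r)) :=
    IsAlgClosed.exists_pow_nat_eq _ two_pos
  have hc0 : (c : ℂ) ≠ 0 := by exact_mod_cast P.c_pos.ne'
  have hm0 : (m : ℂ) ≠ 0 := by exact_mod_cast P.m_pos.ne'
  have ht1 : 0 < t := by have := P.t_odd; omega
  have ht0 : (t : ℂ) ≠ 0 := by exact_mod_cast ht1.ne'
  have htq : (t : ℚ) ≠ 0 := by exact_mod_cast ht1.ne'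
  have hs0 : s ≠ 0 := by
    rintro rfl
    have : (p : ℚ) ≠ 0 := by exact_mod_cast hp.ne'
    apply this
    linarith
  have hsc : (s : ℂ) ≠ 0 := by exact_mod_cast hs0
  have hb0 : (b : ℂ) ≠ 0 := by exact_mod_cast hb.ne'
  have hN : (d * m ^ 2 - t ^ 2 : ℂ) = 1 := by
    exact_mod_cast congrArg (Rat.cast : ℚ → ℂ) P.norm_rat
  have hnb : (n * b ^ 2 : ℂ) = p * m := by exact_mod_cast hn
  have hscc : (s * c : ℂ) = -2 * p := by exact_mod_cast congrArg (Rat.cast : ℚ → ℂ) hs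
  have hunit : (t + m * r) * (m * r - t) = 1 := by linear_combination (m ^ 2 : ℂ) * hr2 + hN
  have hmr : (m * r) ^ 2 = t ^ 2 + 1 := by linear_combination (m ^ 2 : ℂ) * hr2 + hN
  -- Since (m r)² = t² + 1, this replaces m r + t by 2(m r + 1) up to a square, turning α² into the
  -- shape s · m r (m r + 1) of a squared root.
  have hγ : (m * r + 1 + t) ^ 2 = 2 * (m * r + 1) * (m * r + t) := by linear_combination -hmr
  have hγ0 : m * r + 1 + t ≠ 0 := by
    intro h
    have h1 : ((m * √(d : ℝ) + 1 + t : ℝ) : ℂ) = 0 := by push_cast; exact h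
    have h2 : (m * √(d : ℝ) + 1 + t : ℝ) = 0 := by exact_mod_cast h1
    have : (0 : ℝ) < m * √(d : ℝ) + 1 + t := by positivity
    linarith
  have hu0 : m * r - t ≠ 0 := right_ne_zero_of_mul_eq_one hunit
  set x : ℂ := α * (b * (m * r + 1 + t) * (m * r - t)) / c with hx
  have hxc : x * c = α * (b * (m * r + 1 + t) * (m * r - t)) := by rw [hx]; field_simp
  have hx2 : x ^ 2 = s * (t ^ 2 + 1 + m * r) := by
    have h1 : (x * c) ^ 2 = -(c * p * m * r) * (2 * (m * r + 1)) := by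
      rw [hxc, mul_pow, hα, mul_pow, mul_pow, hγ]
      linear_combination (-2 * c * r * (m * r + 1) * ((m * r + t) * (m * r - t)) ^ 2) * hnb
        - 2 * c * p * m * r * (m * r + 1) * ((m * r + t) * (m * r - t) + 1) * hunit
    apply mul_right_cancel₀ (pow_ne_zero 2 hc0)
    rw [← mul_pow, h1]
    linear_combination (-(t ^ 2 + 1 + m * r) * c) * hscc + (-2 * c * p) * hmr
  -- Chosen so that x y = s t m r, whose square s² t² (t² + 1) is the constant term of the quartic.
  set y : ℂ := x * (m * r - 1) / t with hy
  have hy2 : y ^ 2 = s * (t ^ 2 + 1 - m * r) := by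
    rw [hy, div_pow, mul_pow, hx2]
    field_simp
    linear_combination (t ^ 2 - 1 + m * r) * hmr
  have hroots : ∀ z : ℂ, z ∈ (quarticPoly s t).rootSet ℂ ↔ z ^ 2 = x ^ 2 ∨ z ^ 2 = y ^ 2 := by
    intro z
    have h1 : z ^ 4 - 2 * s * (t ^ 2 + 1) * z ^ 2 + s ^ 2 * t ^ 2 * (t ^ 2 + 1) =
        (z ^ 2 - x ^ 2) * (z ^ 2 - y ^ 2) := by
      rw [hx2, hy2]
      linear_combination (s ^ 2 : ℂ) * hmr
    rw [mem_rootSet_quarticPoly hs0 htq, ← sub_eq_zero (a := z ^ 2) (b := x ^ 2),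
      ← sub_eq_zero (a := z ^ 2) (b := y ^ 2), ← mul_eq_zero, ← h1]
    push_cast
    rfl
  have hxK : x ∈ (quarticField s t).1 :=
    IntermediateField.subset_adjoin ℚ _ ((hroots x).mpr (Or.inl rfl))
  have hQ : ∀ q : ℚ, (q : ℂ) ∈ (quarticField s t).1 := fun q =>
    (quarticField s t).1.algebraMap_mem q
  have hNat : ∀ k : ℕ, (k : ℂ) ∈ (quarticField s t).1 := fun k => natCast_mem _ k
  have hrK : r ∈ (quarticField s t).1 := by
    have h1 : r = (x ^ 2 / s - (t ^ 2 + 1)) / m := by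
      rw [hx2]
      field_simp
      ring
    rw [h1]
    exact div_mem (sub_mem (div_mem (pow_mem hxK 2) (hQ s))
      (add_mem (pow_mem (hNat t) 2) (one_mem _))) (hNat m)
  have hαK : α ∈ (quarticField s t).1 := by
    have h1 : α = x * c / (b * (m * r + 1 + t) * (m * r - t)) := by
      rw [hxc]
      field_simp
    have hmrK := mul_mem (hNat m) hrK
    rw [h1]
    exact div_mem (mul_mem hxK (hNat c)) (mul_mem (mul_mem (hNat b)
      (add_mem (add_mem hmrK (one_mem _)) (hNat t))) (sub_mem hmrK (hNat t)))
  refine ⟨α, ⟨P, isGalois_quarticField s t, hrK, hαK, hα, ?_⟩⟩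
  -- S is the ℚ-span of 1, r, α, r α. It is closed under ring operations and contains the roots,
  -- hence contains the algebra they generate; that algebra is already the field because the roots
  -- are algebraic.
  let S (z : ℂ) : Prop := ∃ x₀ x₁ x₂ x₃ : ℚ, z = x₀ + x₁ * r + (x₂ + x₃ * r) * α
  have hmul : ∀ z z', S z → S z' → S (z * z') := by
    rintro _ _ ⟨x₀, x₁, x₂, x₃, rfl⟩ ⟨y₀, y₁, y₂, y₃, rfl⟩
    refine ⟨x₀ * y₀ + d * x₁ * y₁
        - c * n * d * (m * (x₂ * y₂ + d * x₃ * y₃) + t * (x₂ * y₃ + x₃ * y₂)),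
      x₀ * y₁ + x₁ * y₀ - c * n * (t * (x₂ * y₂ + d * x₃ * y₃) + m * d * (x₂ * y₃ + x₃ * y₂)),
      x₀ * y₂ + d * x₁ * y₃ + x₂ * y₀ + d * x₃ * y₁, x₀ * y₃ + x₁ * y₂ + x₂ * y₁ + x₃ * y₀, ?_⟩
    push_cast
    linear_combination ((x₂ + x₃ * r) * (y₂ + y₃ * r)) * hα
      + (x₁ * y₁ + (x₁ * y₃ + x₃ * y₁) * α - c * n * m * (x₂ * y₂ + d * x₃ * y₃)
        - c * n * t * (x₂ * y₃ + x₃ * y₂) - c * n * r * (m * (x₂ * y₃ + x₃ * y₂) + t * x₃ * y₃)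
        - c * n * m * r ^ 2 * x₃ * y₃) * hr2
  have hadd : ∀ z z', S z → S z' → S (z + z') := by
    rintro _ _ ⟨x₀, x₁, x₂, x₃, rfl⟩ ⟨y₀, y₁, y₂, y₃, rfl⟩
    exact ⟨x₀ + y₀, x₁ + y₁, x₂ + y₂, x₃ + y₃, by push_cast; ring⟩
  have hrat : ∀ q : ℚ, S q := fun q => ⟨q, 0, 0, 0, by simp⟩
  have hSx : S x := by
    have h1 : S (((1 / c : ℚ) : ℂ) * (0 + 0 * r + (b + 0 * r) * α)
        * (((1 + t : ℚ) : ℂ) + ((m : ℚ) : ℂ) * r + (0 + 0 * r) * α)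
        * (((-t : ℚ) : ℂ) + ((m : ℚ) : ℂ) * r + (0 + 0 * r) * α)) :=
      hmul _ _ (hmul _ _ (hmul _ _ (hrat _) ⟨0, 0, b, 0, by simp⟩) ⟨1 + t, m, 0, 0, by simp⟩)
        ⟨-t, m, 0, 0, by simp⟩
    convert h1 using 1
    rw [hx]
    push_cast
    ring
  have hSy : S y := by
    have h1 : S (x * (((-1 / t : ℚ) : ℂ) + ((m / t : ℚ) : ℂ) * r + (0 + 0 * r) * α)) :=
      hmul _ _ hSx ⟨-1 / t, m / t, 0, 0, by simp⟩
    convert h1 using 1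
    rw [hy]
    push_cast
    ring
  have hneg : ∀ z, S z → S (-z) := fun z hz => by
    simpa using hmul _ _ (hrat (-1)) hz
  intro z hz
  have hz' : z ∈ Algebra.adjoin ℚ ((quarticPoly s t).rootSet ℂ) := by
    rw [← IntermediateField.adjoin_toSubalgebra_of_isAlgebraic
      fun _ hx => isAlgebraic_of_mem_rootSet hx]
    exact hz
  clear hz
  induction hz' using Algebra.adjoin_induction with
  | mem w hw =>
    rcases (hroots w).mp hw with h | h
    · rcases sq_eq_sq_iff_eq_or_eq_neg.mp h with rfl | rfl
      exacts [hSx, hneg _ hSx]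
    · rcases sq_eq_sq_iff_eq_or_eq_neg.mp h with rfl | rfl
      exacts [hSy, hneg _ hSy]
  | algebraMap q => exact hrat q
  | add u v _ _ hu hv => exact hadd _ _ hu hv
  | mul u v _ _ hu hv => exact hmul _ _ hu hv

end Field

/-! ### Distinctness of the fields -/

/-- The numbers `p q` and `2 p²` remain non-squares when multiplied by `1` or `d`. -/
lemma not_sq_of_primes {d p q c c' : ℕ} (hd : Squarefree d) (hd4 : d % 4 = 2) (hd2 : 2 < d)
    (hp : p.Prime) (hq : q.Prime) (hdp : d < p) (hc : c = 1 ∨ c = 2) (hc' : c' = 1 ∨ c' = 2)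
    (hne : p ≠ q ∨ c ≠ c') {δ : ℕ} (hδ : δ = 1 ∨ δ = d) (j : ℚ) :
    (c * p * (c' * q) * δ : ℚ) ≠ j ^ 2 := by
  intro h
  obtain ⟨j, rfl⟩ := exists_int_of_sq_eq (q := j) (k := c * p * (c' * q) * δ)
    (by push_cast; exact h.symm)
  have h1 : c * p * (c' * q) * δ = j.natAbs ^ 2 := by
    have h2 : (c * p * (c' * q) * δ : ℤ) = j ^ 2 := by exact_mod_cast h
    rw [← Int.natAbs_sq] at h2
    exact_mod_cast h2
  have hpj : p ∣ j.natAbs := hp.dvd_of_dvd_pow (n := 2) ⟨c * (c' * q) * δ, by rw [← h1]; ring⟩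
  obtain ⟨k, hk⟩ := hpj
  have h2 : c * (c' * q) * δ = p * k ^ 2 := by
    apply Nat.eq_of_mul_eq_mul_left hp.pos
    calc p * (c * (c' * q) * δ) = c * p * (c' * q) * δ := by ring
      _ = p * (p * k ^ 2) := by rw [h1, hk]; ring
  have hpc : ∀ c : ℕ, (c = 1 ∨ c = 2) → ¬ p ∣ c := by
    rintro c hc h3
    have := Nat.le_of_dvd (by omega) h3
    omega
  have hpδ : ¬ p ∣ δ := by
    intro h3
    have := Nat.le_of_dvd (by omega) h3
    omega
  have hpq : p = q := by
    have h3 : p ∣ c * (c' * q) * δ := ⟨k ^ 2, h2⟩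
    rcases hp.dvd_mul.mp h3 with h3 | h3
    · rcases hp.dvd_mul.mp h3 with h3 | h3
      · exact absurd h3 (hpc c hc)
      · rcases hp.dvd_mul.mp h3 with h3 | h3
        · exact absurd h3 (hpc c' hc')
        · exact (Nat.prime_dvd_prime_iff_eq hp hq).mp h3
    · exact absurd h3 hpδ
  subst hpq
  have hcc : c * c' = 2 := by
    rcases hc with rfl | rfl <;> rcases hc' with rfl | rfl <;> simp_all
  -- Left with p = q and c c' = 2: δ = 1 would make 2 a square, and δ = d would give d = 2 l², hence
  -- d = 2 by squarefreeness, against 2 < d.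
  have h3 : 2 * δ = k ^ 2 := by
    apply Nat.eq_of_mul_eq_mul_left hp.pos
    rw [← h2, ← hcc]; ring
  have h2k : 2 ∣ k := Nat.prime_two.dvd_of_dvd_pow (n := 2) ⟨δ, h3.symm⟩
  obtain ⟨l, rfl⟩ := h2k
  have h4 : δ = 2 * l ^ 2 := by
    ring_nf at h3
    omega
  rcases hδ with rfl | rfl
  · omega
  · have := Nat.isUnit_iff.mp (hd l ⟨2, by rw [h4]; ring⟩)
    subst this
    omega

lemma CGen.ne_of_primes {K K' : NumField} {d t m c c' a p q : ℕ} {α α' : ℂ}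
    (C : CGen K d (p * a) t m c α) (C' : CGen K' d (q * a) t m c' α')
    (hp : p.Prime) (hq : q.Prime) (hdp : d < p) (hne : p ≠ q ∨ c ≠ c') : K ≠ K' := by
  rintro rfl
  have ha : (a : ℚ) ≠ 0 := by
    have := C.n_pos
    exact_mod_cast (Nat.pos_of_mul_pos_left this).ne'
  have hq0 : (c' * q : ℚ) ≠ 0 := by
    exact_mod_cast (Nat.mul_pos C'.c_pos hq.pos).ne'
  have key : ∀ δ : ℕ, (δ = 1 ∨ δ = d) → ∀ j : ℚ, (c * p * (c' * q) * δ : ℚ) ≠ j ^ 2 :=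
    fun δ hδ j => not_sq_of_primes C.sqf_d C.d_mod C.two_lt hp hq hdp C.c_eq C'.c_eq hne hδ j
  obtain ⟨x, h | h⟩ := C.ratio_eq C'
  · apply key 1 (Or.inl rfl) (c' * q * x)
    have h1 : (c * p : ℚ) = c' * q * x ^ 2 := by
      apply mul_right_cancel₀ ha
      push_cast at h
      linear_combination h
    push_cast
    linear_combination (c' * q : ℚ) * h1
  · apply key d (Or.inr rfl) (c' * q * d * x)
    have h1 : (c * p : ℚ) = c' * q * (d * x ^ 2) := by
      apply mul_right_cancel₀ ha
      push_cast at h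
      linear_combination h
    linear_combination (c' * q * d : ℚ) * h1

/-! ### Choice of primes and of t -/

lemma infinite_primes_gt (N : ℕ) : {p : ℕ | p.Prime ∧ N < p}.Infinite := by
  refine Set.infinite_of_forall_exists_gt fun k => ?_
  obtain ⟨p, hp, hpp⟩ := Nat.exists_infinite_primes (max N k + 1)
  exact ⟨p, ⟨hpp, by omega⟩, by omega⟩

/-- A large prime q ≡ 1 mod 4 dividing t² + 1 exactly once must divide its squarefree part d. The
condition t ≡ 5 mod 8 gives t² + 1 ≡ 2 mod 4, hence d ≡ 2 mod 4. -/
lemma exists_param (B : ℕ) : ∃ t d m : ℕ, t ≡ 5 [MOD 8] ∧ t ^ 2 + 1 = d * m ^ 2 ∧ Squarefree d ∧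
    d % 4 = 2 ∧ B < d := by
  obtain ⟨q, hq, hBq, hq4⟩ := Nat.exists_prime_gt_modEq_one (k := 4) (B + 2) (by norm_num)
  have : Fact q.Prime := ⟨hq⟩
  have hq4' : q % 4 = 1 := hq4
  obtain ⟨y, hy⟩ := ZMod.exists_sq_eq_neg_one_iff.mpr (show q % 4 ≠ 3 by omega)
  have hx0 : q ∣ y.val ^ 2 + 1 := by
    rw [← ZMod.natCast_eq_zero_iff]
    push_cast
    rw [ZMod.natCast_zmod_val, sq, ← hy]
    ring
  -- Both y and y + q are roots of −1 mod q, and modulo q² the values of X² + 1 there differ by 2 q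
  -- y, so q² cannot divide both.
  obtain ⟨x, hx, hxq⟩ : ∃ x : ℕ, q ∣ x ^ 2 + 1 ∧ ¬ q ^ 2 ∣ x ^ 2 + 1 := by
    by_cases h : q ^ 2 ∣ y.val ^ 2 + 1
    · refine ⟨y.val + q, ?_, ?_⟩
      · have : (y.val + q) ^ 2 + 1 = (y.val ^ 2 + 1) + q * (2 * y.val + q) := by ring
        rw [this]
        exact dvd_add hx0 (Dvd.intro _ rfl)
      · intro h'
        have h1 : (y.val + q) ^ 2 + 1 = (y.val ^ 2 + 1) + (q ^ 2 + q * (2 * y.val)) := by ring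
        rw [h1] at h'
        have h2 := (Nat.dvd_add_right (dvd_refl _)).mp ((Nat.dvd_add_right h).mp h')
        rw [sq] at h2
        have h3 := Nat.dvd_of_mul_dvd_mul_left hq.pos h2
        rcases hq.dvd_mul.mp h3 with h4 | h4
        · have := Nat.le_of_dvd two_pos h4
          omega
        · have h5 : q ∣ y.val ^ 2 := dvd_pow h4 two_ne_zero
          exact hq.one_lt.ne' (Nat.dvd_one.mp ((Nat.dvd_add_right h5).mp hx0))
    · exact ⟨y.val, hx0, h⟩
  have hcop : Nat.Coprime 8 (q ^ 2) := by
    apply Nat.Coprime.pow_right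
    apply Nat.Coprime.pow_left 3 (m := 2)
    rw [Nat.coprime_two_left, Nat.odd_iff]
    omega
  obtain ⟨t, ht8, htq⟩ := Nat.chineseRemainder hcop 5 x
  have htq' : t ^ 2 + 1 ≡ x ^ 2 + 1 [MOD q ^ 2] := (htq.pow 2).add_right 1
  have h1 : q ∣ t ^ 2 + 1 := ((htq'.of_dvd (dvd_pow_self q two_ne_zero)).dvd_iff (dvd_refl q)).mpr hx
  have h2 : ¬ q ^ 2 ∣ t ^ 2 + 1 := fun h => hxq ((htq'.dvd_iff (dvd_refl _)).mp h)
  obtain ⟨d, m, hdm, hd⟩ := Nat.sq_mul_squarefree (t ^ 2 + 1)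
  refine ⟨t, d, m, ht8, by rw [← hdm, mul_comm], hd, ?_, ?_⟩
  · have h8 : t % 8 = 5 := ht8
    obtain ⟨k, rfl⟩ : ∃ k, t = 8 * k + 5 := ⟨t / 8, by omega⟩
    rcases Nat.even_or_odd' m with ⟨l, rfl | rfl⟩
    · ring_nf at hdm
      omega
    · have h3 : (2 * l + 1) ^ 2 * d = 4 * ((l ^ 2 + l) * d) + d := by ring
      have h4 : (8 * k + 5) ^ 2 + 1 = 4 * (16 * k ^ 2 + 20 * k + 6) + 2 := by ring
      rw [h3, h4] at hdm
      omega
  · have h3 : q ∣ d := by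
      rw [← hdm] at h1 h2
      rcases hq.dvd_mul.mp h1 with h4 | h4
      · exact absurd ((pow_dvd_pow_of_dvd (hq.dvd_of_dvd_pow h4) 2).mul_right d) h2
      · exact h4
    have := Nat.le_of_dvd (Nat.pos_of_ne_zero hd.ne_zero) h3
    omega

end QuarticCM
-- Assembly
theorem theorem1p3 (M : ℝ) (hM : 0 < M) :
    ∃ R : ℝ, M < R ∧
      -- (i) infinitely many imaginary cyclic quartic fields with regulator `R`
      {K : QuarticCM.NumField |
        QuarticCM.IsImaginaryCyclicQuartic K ∧ QuarticCM.reg K = R}.Infinite ∧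
      -- (ii) infinitely many pairs of distinct such fields with equal discriminants
      {P : QuarticCM.NumField × QuarticCM.NumField |
        QuarticCM.IsImaginaryCyclicQuartic P.1 ∧ QuarticCM.IsImaginaryCyclicQuartic P.2 ∧
        P.1 ≠ P.2 ∧ QuarticCM.disc P.1 = QuarticCM.disc P.2 ∧
        QuarticCM.reg P.1 = R ∧ QuarticCM.reg P.2 = R}.Infinite ∧
      -- the explicit fields: one `t`, and all primes `p > t ^ 2 + 1`
      ∃ t : ℕ, t ≡ 5 [MOD 8] ∧
        (∀ p : ℕ, p.Prime → t ^ 2 + 1 < p →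
          QuarticCM.IsImaginaryCyclicQuartic (QuarticCM.quarticField (-(p : ℚ)) (t : ℚ)) ∧
          QuarticCM.IsImaginaryCyclicQuartic (QuarticCM.quarticField (-2 * (p : ℚ)) (t : ℚ)) ∧
          QuarticCM.quarticField (-(p : ℚ)) (t : ℚ) ≠
            QuarticCM.quarticField (-2 * (p : ℚ)) (t : ℚ) ∧
          QuarticCM.disc (QuarticCM.quarticField (-(p : ℚ)) (t : ℚ)) =
            QuarticCM.disc (QuarticCM.quarticField (-2 * (p : ℚ)) (t : ℚ)) ∧
          QuarticCM.reg (QuarticCM.quarticField (-(p : ℚ)) (t : ℚ)) = R ∧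
          QuarticCM.reg (QuarticCM.quarticField (-2 * (p : ℚ)) (t : ℚ)) = R) ∧
        (∀ p q : ℕ, p.Prime → q.Prime → t ^ 2 + 1 < p → t ^ 2 + 1 < q → p ≠ q →
          QuarticCM.quarticField (-(p : ℚ)) (t : ℚ) ≠
            QuarticCM.quarticField (-(q : ℚ)) (t : ℚ) ∧
          QuarticCM.quarticField (-2 * (p : ℚ)) (t : ℚ) ≠
            QuarticCM.quarticField (-2 * (q : ℚ)) (t : ℚ) ∧
          QuarticCM.quarticField (-(p : ℚ)) (t : ℚ) ≠
            QuarticCM.quarticField (-2 * (q : ℚ)) (t : ℚ)) := by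
  open QuarticCM in
  -- The bound gives log d > M; the extra 2 guarantees 2 < d.
  obtain ⟨t, d, m, ht, hnorm, hd, hd4, hBd⟩ := exists_param (⌈Real.exp M⌉₊ + 2)
  -- Removing the square b² from m keeps n = p a squarefree, as p > t² + 1 ≥ m cannot divide a.
  obtain ⟨a, b, hab, ha⟩ := Nat.sq_mul_squarefree m
  have ht0 : 0 < t := by
    rcases Nat.eq_zero_or_pos t with rfl | h
    · simp [Nat.ModEq] at ht
    · exact h
  have hm : 0 < m := by
    rcases Nat.eq_zero_or_pos m with rfl | h
    · simp at hnorm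
    · exact h
  have hb : 0 < b := by
    rcases Nat.eq_zero_or_pos b with rfl | h
    · simp at hab; omega
    · exact h
  have ham : a ∣ m := ⟨b ^ 2, by rw [← hab]; ring⟩
  have hmodd : m % 2 = 1 := by
    by_contra hm2
    obtain ⟨l, rfl⟩ : 2 ∣ m := by omega
    have h5 : t % 8 = 5 := ht
    obtain ⟨k, rfl⟩ : ∃ k, t = 8 * k + 5 := ⟨t / 8, by omega⟩
    ring_nf at hnorm
    omega
  have hmt : m ≤ t ^ 2 + 1 := by
    rw [hnorm]
    nlinarith
  have hdt : d ≤ t ^ 2 + 1 := by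
    rw [hnorm]
    exact Nat.le_mul_of_pos_right d (by positivity)
  have hpar : ∀ p : ℕ, p.Prime → t ^ 2 + 1 < p → ∀ c : ℕ, (c = 1 ∨ c = 2) →
      Params d (p * a) t m c := by
    intro p hp hpt c hc
    refine ⟨hd, hd4, by omega, ?_, ?_, hc, hnorm⟩
    · rw [Nat.squarefree_mul_iff]
      refine ⟨?_, hp.prime.squarefree, ha⟩
      rw [hp.coprime_iff_not_dvd]
      intro h
      have := Nat.le_of_dvd hm (h.trans ham)
      omega
    · have h1 : p % 2 = 1 := by
        rcases hp.eq_two_or_odd with h | h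
        · omega
        · exact h
      have h2 : a % 2 = 1 := by
        obtain ⟨e, he⟩ := ham
        by_contra h2
        have h3 : a % 2 = 0 := by omega
        rw [he, Nat.mul_mod, h3] at hmodd
        simp at hmodd
      rw [Nat.mul_mod, h1, h2]
  have hC2 : ∀ p : ℕ, p.Prime → t ^ 2 + 1 < p →
      ∃ α, CGen (quarticField (-(p : ℚ)) t) d (p * a) t m 2 α := fun p hp hpt =>
    exists_cgen (hpar p hp hpt 2 (Or.inr rfl)) hb hp.pos (by rw [← hab]; ring)
      (by push_cast; ring)
  have hC1 : ∀ p : ℕ, p.Prime → t ^ 2 + 1 < p →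
      ∃ α, CGen (quarticField (-2 * (p : ℚ)) t) d (p * a) t m 1 α := fun p hp hpt =>
    exists_cgen (hpar p hp hpt 1 (Or.inl rfl)) hb hp.pos (by rw [← hab]; ring)
      (by push_cast; ring)
  -- Any single admissible prime can define R, since the regulator depends only on d.
  obtain ⟨p₀, hp₀, hp₀t⟩ := (infinite_primes_gt (t ^ 2 + 1)).nonempty
  obtain ⟨α₀, C₀⟩ := hC1 p₀ hp₀ hp₀t
  have hR : M < reg (quarticField (-2 * (p₀ : ℚ)) t) := by
    refine lt_of_lt_of_le ?_ C₀.log_le_reg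
    rw [Real.lt_log_iff_exp_lt (by exact_mod_cast C₀.d_pos)]
    have h1 := Nat.le_ceil (Real.exp M)
    have h2 : ((⌈Real.exp M⌉₊ + 2 : ℕ) : ℝ) < d := by exact_mod_cast hBd
    push_cast at h2
    linarith
  have hmain : ∀ p : ℕ, p.Prime → t ^ 2 + 1 < p →
      IsImaginaryCyclicQuartic (quarticField (-(p : ℚ)) (t : ℚ)) ∧
      IsImaginaryCyclicQuartic (quarticField (-2 * (p : ℚ)) (t : ℚ)) ∧
      quarticField (-(p : ℚ)) (t : ℚ) ≠ quarticField (-2 * (p : ℚ)) (t : ℚ) ∧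
      disc (quarticField (-(p : ℚ)) (t : ℚ)) = disc (quarticField (-2 * (p : ℚ)) (t : ℚ)) ∧
      reg (quarticField (-(p : ℚ)) (t : ℚ)) = reg (quarticField (-2 * (p₀ : ℚ)) t) ∧
      reg (quarticField (-2 * (p : ℚ)) (t : ℚ)) = reg (quarticField (-2 * (p₀ : ℚ)) t) := by
    intro p hp hpt
    obtain ⟨α₂, C₂⟩ := hC2 p hp hpt
    obtain ⟨α₁, C₁⟩ := hC1 p hp hpt
    exact ⟨C₂.isImaginaryCyclicQuartic, C₁.isImaginaryCyclicQuartic,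
      C₂.ne_of_primes C₁ hp hp (by omega) (Or.inr (by norm_num)),
      by rw [C₂.disc_eq, C₁.disc_eq], C₂.reg_eq C₀, C₁.reg_eq C₀⟩
  have hdist : ∀ p q : ℕ, p.Prime → q.Prime → t ^ 2 + 1 < p → t ^ 2 + 1 < q → p ≠ q →
      quarticField (-(p : ℚ)) (t : ℚ) ≠ quarticField (-(q : ℚ)) (t : ℚ) ∧
      quarticField (-2 * (p : ℚ)) (t : ℚ) ≠ quarticField (-2 * (q : ℚ)) (t : ℚ) ∧
      quarticField (-(p : ℚ)) (t : ℚ) ≠ quarticField (-2 * (q : ℚ)) (t : ℚ) := by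
    intro p q hp hq hpt hqt hpq
    obtain ⟨_, C₂⟩ := hC2 p hp hpt
    obtain ⟨_, C₁⟩ := hC1 p hp hpt
    obtain ⟨_, C₂'⟩ := hC2 q hq hqt
    obtain ⟨_, C₁'⟩ := hC1 q hq hqt
    exact ⟨C₂.ne_of_primes C₂' hp hq (by omega) (Or.inl hpq),
      C₁.ne_of_primes C₁' hp hq (by omega) (Or.inl hpq),
      C₂.ne_of_primes C₁' hp hq (by omega) (Or.inl hpq)⟩
  have hinj : Set.InjOn (fun p : ℕ => quarticField (-(p : ℚ)) (t : ℚ))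
      {p : ℕ | p.Prime ∧ t ^ 2 + 1 < p} := by
    intro p hp q hq hpq
    by_contra hne
    exact (hdist p q hp.1 hq.1 hp.2 hq.2 hne).1 hpq
  refine ⟨_, hR, ?_, ?_, t, ht, hmain, hdist⟩
  · refine Set.infinite_of_injOn_mapsTo hinj (fun p hp => ?_) (infinite_primes_gt (t ^ 2 + 1))
    have h := hmain p hp.1 hp.2
    exact ⟨h.1, h.2.2.2.2.1⟩
  · refine Set.infinite_of_injOn_mapsTo
      (f := fun p : ℕ => (quarticField (-(p : ℚ)) (t : ℚ), quarticField (-2 * (p : ℚ)) (t : ℚ)))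
      (fun p hp q hq hpq => hinj hp hq (congrArg Prod.fst hpq)) (fun p hp => ?_)
      (infinite_primes_gt (t ^ 2 + 1))
    exact hmain p hp.1 hp.2
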